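/- **Setting.** Let $f\in S_2(\Gamma_0(N))$ be a newform and let $\vec f=(f_1,\dots,f_r)^{tr}$ be the vector of its distinct Galois conjugates ($f$ among them). For $\tau$ in the upper half-plane $\mathfrak H$ put $\vec{\mathcal E}(\tau)=-2\pi i\int_\tau^{i\infty}\vec f(z)\,dz$, and let $\Lambda_V\subset\mathbb C^r$ be the period lattice of $\vec f$, i.e. the group generated by the vectors $-2\pi i\int_\tau^{\gamma\tau}\vec f(z)\,dz$ with $\gamma\in\Gamma_0(N)$, $\tau\in\mathfrak H$. Suppose that $\omega,\omega'\in\mathbb C^{r\times r}$ are period matrices, meaning that $\Lambda_V=\omega\mathbb Z^r+\omega'\mathbb Z^r$, $\omega$ is invertible, and $\Omega=\omega^{-1}\omega'$ is symmetric with positive definite imaginary part. Let $\eta\in\mathbb C^{r\times r}$ be any matrix (for instance the matrix of quasi-periods belonging to $\omega$) and $\alpha,\beta\in\mathbb R^r$. For $u\in\mathbb C^r$ define $$\theta\left[\begin{smallmatrix}\alpha\\\beta\end{smallmatrix}\right](u;\Omega)=\sum_{m\in\mathbb Z^r}\exp\left(2\pi i\left((m+\alpha)^{tr}(u+\beta)+\tfrac12(m+\alpha)^{tr}\Omega(m+\alpha)\right)\right),$$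 $$\sigma(u)=\exp\left(\tfrac12u^{tr}\omega^{-1}\eta u\right)\theta\left[\begin{smallmatrix}\alpha\\\beta\end{smallmatrix}\right](\omega^{-1}u;\Omega),$$ and, where $\sigma(u)\neq0$, the row vectors $$\zeta(u)=\nabla_u\log\sigma(u)=\frac{\nabla_u\sigma(u)}{\sigma(u)},$$ $$\widehat\zeta(u)=\zeta(u)-\tfrac12u^{tr}\left(\omega^{-1}\eta+\eta^{tr}\omega^{-tr}\right)+2\pi i\,\mathrm{Im}(\omega^{-1}u)^{tr}\,\mathrm{Im}(\Omega)^{-1}\omega^{-1}.$$ The completed Kleinian mock modular form is $\widehat{\mathfrak Z}_V(\tau)=\widehat\zeta(\vec{\mathcal E}(\tau))$, defined for those $\tau\in\mathfrak H$ with $\sigma(\vec{\mathcal E}(\tau))\neq0$. **Theorem.** Let $Q$ be an exact divisor of $N$, i.e. $Q\mid N$ and $\gcd(Q,N/Q)=1$, and let $W_Q=\begin{pmatrix}Qx&y\\Nz&Qw\end{pmatrix}$ with $x,y,z,w\in\mathbb Z$ and $\det W_Q=Q$ be any matrix representing the corresponding Atkin–Lehner involution. Let $\lambda_Q$ be the eigenvalue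 of $f$ under $W_Q$, i.e. $f|_2W_Q=\lambda_Qf$, where $(f|_2W_Q)(\tau)=Q\,(Nz\tau+Qw)^{-2}f(W_Q\tau)$. Put $$L_Q(\vec f)=-2\pi i\int_{W_Q^{-1}\infty}^{\infty}\vec f(t)\,dt .$$ Then $\lambda_Q\in\{\pm1\}$, and for every $\tau\in\mathfrak H$ one has $\sigma(\vec{\mathcal E}(W_Q\tau))\ne0$ if and only if $\sigma\left(\lambda_Q(\vec{\mathcal E}(\tau)-L_Q(\vec f))\right)\neq0$, and in that case $$\widehat{\mathfrak Z}_V|W_Q(\tau)=\widehat{\mathfrak Z}_V(W_Q\tau)=\widehat\zeta\left(\lambda_Q\left(\vec{\mathcal E}(\tau)-L_Q(\vec f)\right)\right).$$ -/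

import Mathlib

open UpperHalfPlane CongruenceSubgroup MeasureTheory Matrix
open scoped MatrixGroups ModularForm Modular Real OnePoint

noncomputable section

namespace KleinianMock

/-- The space of holomorphic cusp forms of weight two for the group of level `N`. -/
abbrev S2 (N : ℕ) : Type := CuspForm (Gamma0 N : Subgroup (GL (Fin 2) ℝ)) 2

/-- The `n`-th Fourier coefficient of a cusp form at the cusp infinity, in powers of
`exp (2 π i τ)`. -/
def fourierCoeff {N : ℕ} (f : S2 N) (n : ℕ) : ℂ := (qExpansion (1 : ℝ) f).coeff n

/-- A cusp form viewed as a function of a complex variable (only its values on the upper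
half-plane matter). -/
def onComplex {N : ℕ} (f : S2 N) (z : ℂ) : ℂ := f (UpperHalfPlane.ofComplex z)

/-! ### Newforms -/

/-- The Petersson inner product on weight two cusp forms of level `N`: the integral of
`conj (f τ) * g τ * (im τ) ^ 2` for the hyperbolic measure over a fundamental domain, written as
the union of the translates of the standard fundamental domain by representatives of the cosets
`Γ₀(N) γ` in `SL(2, ℤ)` (the inverses of representatives of the cosets `γ Γ₀(N)`). -/
def peterssonInner {N : ℕ} (f g : S2 N) : ℂ :=
  ∑ᶠ c : SL(2, ℤ) ⧸ Gamma0 N, ∫ τ in 𝒟, petersson 2 f g (c.out⁻¹ • τ)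

/-- The basic oldforms `τ ↦ g (d τ)` of level `N`: here `g` is a cusp form of level `M`, a proper
divisor of `N`, and `d` divides `N / M`. -/
def IsBasicOldform {N : ℕ} (h : S2 N) : Prop :=
  ∃ M d : ℕ, M ≠ N ∧ M * d ∣ N ∧ ∃ g : S2 M, ∀ τ : ℍ, h τ = onComplex g (d * (τ : ℂ))

/-- The new subspace: the orthogonal complement of the basic oldforms, hence of their span. -/
def IsInNewSubspace {N : ℕ} (f : S2 N) : Prop :=
  ∀ h : S2 N, IsBasicOldform h → peterssonInner h f = 0

/-- The weight two Hecke operator `T_n` of level `N` (trivial character),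
`T_n f (τ) = n ∑_{a d = n, (a, N) = 1} ∑_{0 ≤ b < d} d ^ (-2) f ((a τ + b) / d)`. -/
def heckeT {N : ℕ} (n : ℕ) (f : S2 N) (τ : ℍ) : ℂ :=
  n * ∑ a ∈ n.divisors with a.Coprime N, ∑ b ∈ Finset.range (n / a),
    (((n / a : ℕ) : ℂ) ^ 2)⁻¹ * onComplex f ((a * (τ : ℂ) + b) / ((n / a : ℕ) : ℂ))

/-- Newforms: normalized eigenforms of all Hecke operators lying in the new subspace. -/
structure IsNewform {N : ℕ} (f : S2 N) : Prop where
  new : IsInNewSubspace f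
  eigen : ∀ n : ℕ, 0 < n → ∃ c : ℂ, ∀ τ : ℍ, heckeT n f τ = c * f τ
  normalized : fourierCoeff f 1 = 1

/-- `g` is a Galois conjugate of `f`: its Fourier coefficients are the images of those of `f`
under one automorphism of `ℂ`. -/
def IsGaloisConjugate {N : ℕ} (f g : S2 N) : Prop :=
  ∃ s : ℂ ≃+* ℂ, ∀ n : ℕ, fourierCoeff g n = s (fourierCoeff f n)

/-- `F` lists the Galois conjugates of `f` (with `f` itself among them), each of them once. -/
structure IsGaloisOrbit {N r : ℕ} (f : S2 N) (F : Fin r → S2 N) : Prop where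
  injective : Function.Injective F
  range_eq : Set.range F = {g | IsGaloisConjugate f g}

/-! ### Integrals of cusp forms -/

/-- The Eichler integral `-2 π i ∫_τ^{i ∞} f (z) dz`, along the vertical half-line
`z = τ + i t`, `t > 0`. -/
def eichler {N : ℕ} (f : S2 N) (τ : ℍ) : ℂ :=
  -2 * π * Complex.I * ∫ t in Set.Ioi (0 : ℝ), onComplex f (τ + t * Complex.I) * Complex.I

/-- The integral `-2 π i ∫_c^∞ f (t) dt` from a cusp `c` to infinity; for a finite cusp along the
vertical half-line above `c`. -/
def cuspToInfty {N : ℕ} (f : S2 N) : OnePoint ℝ → ℂ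
  | ∞ => 0
  | (x : ℝ) =>
    -2 * π * Complex.I * ∫ t in Set.Ioi (0 : ℝ), onComplex f (x + t * Complex.I) * Complex.I

/-- The integral `∫_z^w f`, along the segment joining two points of the upper half-plane. -/
def segmentIntegral {N : ℕ} (f : S2 N) (z w : ℍ) : ℂ :=
  ((w : ℂ) - z) * ∫ t in (0 : ℝ)..1, onComplex f (z + t * ((w : ℂ) - z))

/-- The vector of Eichler integrals. -/
def eichlerVec {N r : ℕ} (F : Fin r → S2 N) (τ : ℍ) : Fin r → ℂ := fun j => eichler (F j) τ

/-- The period lattice in `ℂ ^ r`: the group generated by the periods `-2 π i ∫_τ^{γ τ} (f_j)_j`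
for `γ` in `Γ₀(N)`. Paths from `τ` to `γ τ` give all the integral homology classes of `X₀(N)`. -/
def periodLattice {N r : ℕ} (F : Fin r → S2 N) : AddSubgroup (Fin r → ℂ) :=
  AddSubgroup.closure
    {v | ∃ γ ∈ Gamma0 N, ∃ τ : ℍ,
      v = fun j => -2 * π * Complex.I * segmentIntegral (F j) τ (γ • τ)}

/-! ### The Siegel upper half-space, theta, sigma and zeta functions -/

/-- Entrywise imaginary part of a matrix. -/
def imMatrix {r : ℕ} (A : Matrix (Fin r) (Fin r) ℂ) : Matrix (Fin r) (Fin r) ℝ :=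
  A.map Complex.im

/-- The Siegel upper half-space of genus `r`. -/
def siegelUpperHalfSpace (r : ℕ) : Set (Matrix (Fin r) (Fin r) ℂ) :=
  {Ω | Ωᵀ = Ω ∧ (imMatrix Ω).PosDef}

/-- `ω, ω'` are period matrices for the lattice of `F`: the lattice is `ω ℤ ^ r + ω' ℤ ^ r` and
`ω⁻¹ ω'` lies in the Siegel upper half-space. -/
structure IsPeriodPair {N r : ℕ} (F : Fin r → S2 N) (ω ω' : Matrix (Fin r) (Fin r) ℂ) : Prop where
  isUnit_det : IsUnit ω.det
  siegel : ω⁻¹ * ω' ∈ siegelUpperHalfSpace r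
  lattice : ∀ v : Fin r → ℂ, v ∈ periodLattice F ↔
    ∃ m n : Fin r → ℤ, v = ω *ᵥ (fun i => (m i : ℂ)) + ω' *ᵥ (fun i => (n i : ℂ))

/-- The Riemann theta function with characteristic `[α, β]`. -/
def theta {r : ℕ} (α β : Fin r → ℝ) (u : Fin r → ℂ) (Ω : Matrix (Fin r) (Fin r) ℂ) : ℂ :=
  ∑' m : Fin r → ℤ,
    let x : Fin r → ℂ := fun i => (m i : ℂ) + (α i : ℂ)
    Complex.exp (2 * π * Complex.I *
      (x ⬝ᵥ (u + fun i => (β i : ℂ)) + 1 / 2 * (x ⬝ᵥ (Ω *ᵥ x))))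

/-- The Kleinian sigma function with characteristic `[α, β]`. -/
def sigma {r : ℕ} (ω ω' eta : Matrix (Fin r) (Fin r) ℂ) (α β : Fin r → ℝ) (u : Fin r → ℂ) : ℂ :=
  Complex.exp (1 / 2 * (u ⬝ᵥ ((ω⁻¹ * eta) *ᵥ u))) * theta α β (ω⁻¹ *ᵥ u) (ω⁻¹ * ω')

/-- The Kleinian zeta function, the gradient of `log sigma`, i.e. the vector of the logarithmic
partial derivatives of `sigma`. It is meaningful where `sigma` does not vanish. -/
def zeta {r : ℕ} (ω ω' eta : Matrix (Fin r) (Fin r) ℂ) (α β : Fin r → ℝ) (u : Fin r → ℂ) :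
    Fin r → ℂ :=
  fun j => fderiv ℂ (sigma ω ω' eta α β) u (Pi.single j 1) / sigma ω ω' eta α β u

/-- The completed Kleinian zeta function. -/
def zetaHat {r : ℕ} (ω ω' eta : Matrix (Fin r) (Fin r) ℂ) (α β : Fin r → ℝ) (u : Fin r → ℂ) :
    Fin r → ℂ :=
  zeta ω ω' eta α β u - (1 / 2 : ℂ) • (u ᵥ* (ω⁻¹ * eta + etaᵀ * (ω⁻¹)ᵀ))
    + (2 * π * Complex.I) •
      ((fun i => (((ω⁻¹ *ᵥ u) i).im : ℂ)) ᵥ*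
        (((imMatrix (ω⁻¹ * ω'))⁻¹).map Complex.ofReal * ω⁻¹))

/-- The completed Kleinian mock modular form: the completed Kleinian zeta function evaluated at
the vector of Eichler integrals. -/
def zHat {N r : ℕ} (F : Fin r → S2 N) (ω ω' eta : Matrix (Fin r) (Fin r) ℂ) (α β : Fin r → ℝ)
    (τ : ℍ) : Fin r → ℂ :=
  zetaHat ω ω' eta α β (eichlerVec F τ)

/-! ### Atkin-Lehner involutions -/

/-- `W` is a matrix `(Q x, y; N z, Q w)` of determinant `Q` with integers `x, y, z, w`. -/
def IsAtkinLehnerMatrix (N Q : ℕ) (W : GL (Fin 2) ℝ) : Prop :=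
  ∃ x y z w : ℤ, (Q * x) * (Q * w) - y * (N * z) = (Q : ℤ) ∧
    (W : Matrix (Fin 2) (Fin 2) ℝ) = !![(Q : ℝ) * x, (y : ℝ); (N : ℝ) * z, (Q : ℝ) * w]

/-- The vector `L_Q = -2 π i ∫_{W⁻¹ ∞}^∞ (f_j)_j`. -/
def cuspPeriodVec {N r : ℕ} (F : Fin r → S2 N) (W : GL (Fin 2) ℝ) : Fin r → ℂ :=
  fun j => cuspToInfty (F j) (W⁻¹ • (∞ : OnePoint ℝ))

end KleinianMock

end

/-! `zHat` sees τ only through the vector ℰ of Eichler integrals, so the theorem follows by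
substitution from ℰ(Wτ) = λ(ℰ(τ) - L), which is `eichlerVec_smul`.

For one form g with g|W = λg, let E be the primitive of 2πi g vanishing at i∞. Then E(Wτ) - λE(τ)
has derivative zero, and letting τ tend to the cusp W⁻¹∞ identifies the constant
(`IsAtkinLehnerMatrix.eichler_smul`). The sign λ = ±1 comes from W² being Q times an element of
Γ₀(N).

The main point is that all Galois conjugates of f share the eigenvalue λ
(`slash_eq_of_isGaloisConjugate`), although an automorphism s of ℂ acts only on q-expansions at ∞
and need not be continuous. The remedy is to write f = B/A with A and B polynomials in level one
forms, Δ(τ) and Δ(Nτ) (`exists_mul_prod_eq_lagrangeSum`, by traces to level one and Lagrange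
interpolation). Here s carries level one forms to level one forms and fixes Δ(τ) and Δ(Nτ). Up to
automorphy factors, W replaces τ by Qτ in level one forms and Δ(Nτ) by a rational multiple of
Δ((N/Q)τ). The two operations therefore commute on B/A, and f|W = λf passes to the conjugates
because sλ = λ. -/

open UpperHalfPlane CongruenceSubgroup MeasureTheory Matrix
open scoped MatrixGroups ModularForm Modular Real OnePoint

noncomputable section

namespace KleinianMock

/-! ### Conjugation of q-series by field automorphisms, and its effect on level one forms. -/

section

open Function.Periodic (qParam)
open scoped PowerSeries Manifold

/-! ### Functions given by `q`-series -/

/-- `φ` is the sum of the power series `p` in `q = exp (2 π i τ)`. -/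
def HasQSeries (φ : ℍ → ℂ) (p : ℂ⟦X⟧) : Prop :=
  ∀ τ : ℍ, HasSum (fun n : ℕ => p.coeff n * qParam 1 τ ^ n) (φ τ)

namespace HasQSeries

variable {φ ψ : ℍ → ℂ} {p p' : ℂ⟦X⟧}

lemma add (h : HasQSeries φ p) (h' : HasQSeries ψ p') : HasQSeries (φ + ψ) (p + p') := fun τ => by
  simpa [add_mul] using (h τ).add (h' τ)

lemma smul (h : HasQSeries φ p) (c : ℂ) : HasQSeries (c • φ) (c • p) := fun τ => by
  simpa [mul_assoc] using (h τ).mul_left c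

lemma const (c : ℂ) : HasQSeries (fun _ => c) (PowerSeries.C c) := fun τ => by
  convert! hasSum_single (f := fun n : ℕ => (PowerSeries.C c).coeff n * qParam 1 τ ^ n) 0 ?_
  · simp
  · intro n hn
    simp [PowerSeries.coeff_C, hn]

lemma mul (h : HasQSeries φ p) (h' : HasQSeries ψ p') : HasQSeries (φ * ψ) (p * p') := fun τ => by
  have ha : Summable fun n : ℕ => ‖p.coeff n * qParam 1 τ ^ n‖ := (h τ).summable.norm
  have hb : Summable fun n : ℕ => ‖p'.coeff n * qParam 1 τ ^ n‖ := (h' τ).summable.norm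
  have hsum := (summable_norm_sum_mul_antidiagonal_of_summable_norm ha hb).of_norm.hasSum
  rw [← tsum_mul_tsum_eq_tsum_sum_antidiagonal_of_summable_norm ha hb,
    (h τ).tsum_eq, (h' τ).tsum_eq] at hsum
  refine hsum.congr_fun fun n => ?_
  rw [PowerSeries.coeff_mul, Finset.sum_mul]
  refine Finset.sum_congr rfl fun kl hkl => ?_
  rw [← Finset.HasAntidiagonal.mem_antidiagonal.mp hkl, pow_add]
  ring

/-- Uniqueness of q-expansions, applied to the zero form; its weight and level are irrelevant. -/
lemma eq_zero (h : HasQSeries 0 p) : p = 0 := by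
  ext n
  have := ModularFormClass.qExpansion_coeff_unique (f := (0 : ModularForm 𝒮ℒ 0))
    (c := fun n => p.coeff n) one_pos one_mem_strictPeriods_SL h n
  simpa [qExpansion_zero] using this

lemma unique (h : HasQSeries φ p) (h' : HasQSeries φ p') : p = p' := by
  have key := h.add (h'.smul (-1))
  rw [neg_one_smul, neg_one_smul, add_neg_cancel] at key
  exact add_neg_eq_zero.mp key.eq_zero

lemma eq_fun (h : HasQSeries φ p) (h' : HasQSeries ψ p) : φ = ψ :=
  funext fun τ => (h τ).unique (h' τ)

/-- Replacing `τ` by `d τ` replaces `q` by `q ^ d`. -/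
lemma expand (h : HasQSeries φ p) {d : ℕ} (hd : d ≠ 0) {ι : ℍ → ℍ}
    (hι : ∀ τ, (ι τ : ℂ) = d * τ) : HasQSeries (φ ∘ ι) (p.expand d hd) := fun τ => by
  have hinj : Function.Injective (fun n : ℕ => d * n) := fun a b hab =>
    Nat.eq_of_mul_eq_mul_left (Nat.pos_of_ne_zero hd) hab
  rw [← hinj.hasSum_iff]
  · refine (h (ι τ)).congr_fun fun n => ?_
    simp only [Function.comp_apply, PowerSeries.coeff_expand_mul, hι, pow_mul]
    congr 2
    simp only [qParam, ← Complex.exp_nat_mul]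
    congr 1
    push_cast
    ring
  · intro n hn
    rw [PowerSeries.coeff_expand_of_not_dvd, zero_mul]
    rintro ⟨m, rfl⟩
    exact hn ⟨m, rfl⟩

end HasQSeries

lemma hasQSeries_qExpansion {F : Type*} [FunLike F ℍ ℂ] {Γ : Subgroup (GL (Fin 2) ℝ)} {k : ℤ}
    [ModularFormClass F Γ k] [Fact (IsCusp OnePoint.infty Γ)] (f : F)
    (hΓ : (1 : ℝ) ∈ Γ.strictPeriods) : HasQSeries f (qExpansion 1 f) :=
  fun τ => ModularForm.hasSum_qExpansion (f := f) one_pos hΓ τ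

/-- `φ` and `ψ` are given by `q`-series that correspond to each other under `s`. -/
def AreConj (s : ℂ ≃+* ℂ) (φ ψ : ℍ → ℂ) : Prop :=
  ∃ p : ℂ⟦X⟧, HasQSeries φ p ∧ HasQSeries ψ (p.map s.toRingHom)

namespace AreConj

variable {s : ℂ ≃+* ℂ} {φ ψ φ' ψ' : ℍ → ℂ}

lemma add (h : AreConj s φ ψ) (h' : AreConj s φ' ψ') : AreConj s (φ + φ') (ψ + ψ') := by
  obtain ⟨p, hp, hq⟩ := h
  obtain ⟨p', hp', hq'⟩ := h'
  exact ⟨p + p', hp.add hp', by simpa using hq.add hq'⟩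

lemma mul (h : AreConj s φ ψ) (h' : AreConj s φ' ψ') : AreConj s (φ * φ') (ψ * ψ') := by
  obtain ⟨p, hp, hq⟩ := h
  obtain ⟨p', hp', hq'⟩ := h'
  exact ⟨p * p', hp.mul hp', by simpa using hq.mul hq'⟩

lemma const (s : ℂ ≃+* ℂ) (c : ℂ) : AreConj s (fun _ => c) (fun _ => s c) :=
  ⟨_, .const c, by simpa using! HasQSeries.const (s c)⟩

lemma smul (h : AreConj s φ ψ) (c : ℂ) : AreConj s (c • φ) (s c • ψ) :=
  (const s c).mul h

lemma ratCast_smul (h : AreConj s φ ψ) (c : ℚ) : AreConj s ((c : ℂ) • φ) ((c : ℂ) • ψ) := by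
  simpa using h.smul c

lemma sub (h : AreConj s φ ψ) (h' : AreConj s φ' ψ') : AreConj s (φ - φ') (ψ - ψ') := by
  simpa [sub_eq_add_neg] using h.add (h'.smul (-1))

lemma zero (s : ℂ ≃+* ℂ) : AreConj s 0 0 := by simpa using! const s 0

lemma one (s : ℂ ≃+* ℂ) : AreConj s 1 1 := by simpa using! const s 1

lemma sum {ι : Type*} {t : Finset ι} {Φ Ψ : ι → ℍ → ℂ} (h : ∀ i ∈ t, AreConj s (Φ i) (Ψ i)) :
    AreConj s (∑ i ∈ t, Φ i) (∑ i ∈ t, Ψ i) := by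
  classical
  induction t using Finset.induction_on with
  | empty => simpa using zero s
  | insert i t hi ih =>
    rw [Finset.sum_insert hi, Finset.sum_insert hi]
    exact (h i (by simp)).add (ih fun j hj => h j (by simp [hj]))

lemma prod {ι : Type*} {t : Finset ι} {Φ Ψ : ι → ℍ → ℂ} (h : ∀ i ∈ t, AreConj s (Φ i) (Ψ i)) :
    AreConj s (∏ i ∈ t, Φ i) (∏ i ∈ t, Ψ i) := by
  classical
  induction t using Finset.induction_on with
  | empty => simpa using one s
  | insert i t hi ih =>
    rw [Finset.prod_insert hi, Finset.prod_insert hi]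
    exact (h i (by simp)).mul (ih fun j hj => h j (by simp [hj]))

lemma right_unique (h : AreConj s φ ψ) (h' : AreConj s φ ψ') : ψ = ψ' := by
  obtain ⟨p, hp, hq⟩ := h
  obtain ⟨p', hp', hq'⟩ := h'
  obtain rfl := hp.unique hp'
  exact hq.eq_fun hq'

lemma eq_zero (h : AreConj s φ 0) : φ = 0 := by
  obtain ⟨p, hp, hq⟩ := h
  have : p = 0 := by
    refine PowerSeries.map_injective s.toRingHom s.injective ?_
    rw [hq.eq_zero, map_zero]
  subst this
  exact hp.eq_fun (by simpa using! HasQSeries.const 0)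

lemma expand (h : AreConj s φ ψ) {d : ℕ} (hd : d ≠ 0) {ι : ℍ → ℍ}
    (hι : ∀ τ, (ι τ : ℂ) = d * τ) : AreConj s (φ ∘ ι) (ψ ∘ ι) := by
  obtain ⟨p, hp, hq⟩ := h
  exact ⟨_, hp.expand hd hι, by simpa [PowerSeries.map_expand] using hq.expand hd hι⟩

end AreConj

/-! ### Level one -/

/-- The Fourier coefficients are rational, hence fixed by every automorphism. -/
lemma areConj_eisenstein (s : ℂ ≃+* ℂ) {k : ℕ} (hk : 3 ≤ k) (hk2 : Even k) :
    AreConj s (ModularForm.E hk) (ModularForm.E hk) := by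
  have h := hasQSeries_qExpansion (ModularForm.E hk) one_mem_strictPeriods_SL
  refine ⟨_, h, ?_⟩
  convert! h
  ext n
  rw [PowerSeries.coeff_map, EisensteinSeries.E_qExpansion_coeff hk hk2]
  split_ifs <;> simp [map_ofNat s]

lemma areConj_discriminant (s : ℂ ≃+* ℂ) :
    AreConj s ModularForm.discriminant ModularForm.discriminant := by
  have h4 := areConj_eisenstein s (k := 4) (by norm_num) ⟨2, rfl⟩
  have h6 := areConj_eisenstein s (k := 6) (by norm_num) ⟨3, rfl⟩
  have := ((h4.mul (h4.mul h4)).sub (h6.mul h6)).ratCast_smul (1 / 1728)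
  convert! this using 1 <;>
  · ext τ
    rw [ModularForm.discriminant_eq_E₄_cube_sub_E₆_sq]
    simp
    ring

/-- Induction on the weight: subtracting a multiple of `E` leaves a cusp form, which is Δ times a
form of weight smaller by 12. Both `E` and Δ are fixed by `s`. -/
lemma exists_areConj_levelOne (s : ℂ ≃+* ℂ) (n : ℕ) : ∀ (k : ℤ) (_ : k < n)
    (B : ModularForm 𝒮ℒ k), ∃ B' : ModularForm 𝒮ℒ k, AreConj s B B' := by
  induction n with
  | zero =>
    intro k hk B
    refine ⟨0, ?_⟩
    have : ⇑B = 0 := ModularFormClass.levelOne_neg_weight_eq_zero (by exact_mod_cast hk) B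
    simpa [this] using! AreConj.zero s
  | succ n ih =>
    intro k hk B
    rcases lt_or_ge k n with hkn | hkn
    · exact ih k hkn B
    obtain rfl : k = n := by omega
    rcases Nat.even_or_odd n with hev | hodd
    swap
    · rw [ModularForm.levelOne_odd_weight_eq_zero (by exact_mod_cast hodd) B]
      exact ⟨0, by simpa using! AreConj.zero s⟩
    rcases lt_or_ge n 3 with h3 | h3
    · obtain rfl | rfl : n = 0 ∨ n = 2 := by
        have : n ≠ 1 := by rintro rfl; simp at hev
        omega
      · obtain ⟨c, hc⟩ := ModularFormClass.levelOne_weight_zero_const B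
        exact ⟨ModularForm.const (s c), by simpa [hc] using! AreConj.const s c⟩
      · rw [rank_zero_iff_forall_zero.mp ModularForm.levelOne_weight_two_rank_zero B]
        exact ⟨0, by simpa using! AreConj.zero s⟩
    obtain ⟨C, hC⟩ := ModularForm.sub_smul_isCuspForm B (ModularForm.E h3)
      (EisensteinSeries.E_qExpansion_coeff_zero h3 hev)
    set c := (qExpansion 1 B).coeff 0
    obtain ⟨D', hD'⟩ := ih (n - 12) (by omega) (CuspForm.discriminantEquiv C)
    refine ⟨s c • ModularForm.E h3 +
      ModularFormClass.modularForm (CuspForm.discriminantEquiv.symm D'), ?_⟩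
    have key := ((areConj_eisenstein s h3 hev).smul c).add ((areConj_discriminant s).mul hD')
    rw [ModularForm.discriminant_mul_discriminantEquiv] at key
    have hB : (B : ℍ → ℂ) = c • ⇑(ModularForm.E h3) + ⇑C := by
      ext τ
      have := DFunLike.congr_fun hC τ
      simp only [FunLike.coe_sub, FunLike.coe_smul, Pi.sub_apply, Pi.smul_apply] at this
      simp only [Pi.add_apply, Pi.smul_apply]
      rw [← sub_eq_iff_eq_add']
      exact this.symm
    rw [hB]
    exact key

end

/-! ### Interpolation and traces from level Γ to level one. -/

section

open scoped Manifold

/-! ### Interpolation -/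

/-- Lagrange interpolation at `0, …, n - 1` of the polynomial
`∑ c, g c * ∏ b ≠ c, (d * X - h b)`, evaluated at `h c₀ / d`. -/
lemma pow_mul_prod_sub_eq_sum {ι : Type*} [Fintype ι] [DecidableEq ι] (g h : ι → ℂ) {d : ℂ}
    (hd : d ≠ 0) (c₀ : ι) :
    d ^ (Fintype.card ι - 1) * (g c₀ * ∏ b ∈ Finset.univ.erase c₀, (h c₀ - h b)) =
      ∑ t ∈ Finset.range (Fintype.card ι),
        (∑ c, g c * ∏ b ∈ Finset.univ.erase c, (t * d - h b)) *
          ∏ s ∈ (Finset.range (Fintype.card ι)).erase t,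
            ((((t : ℚ) - s)⁻¹ : ℚ) : ℂ) * (h c₀ - s * d) := by
  set n := Fintype.card ι with hn
  have hnpos : 0 < n := Fintype.card_pos_iff.mpr ⟨c₀⟩
  set P : Polynomial ℂ := ∑ c, Polynomial.C (g c) *
    ∏ b ∈ Finset.univ.erase c, (Polynomial.C d * Polynomial.X - Polynomial.C (h b)) with hP
  have heval (x : ℂ) : P.eval x = ∑ c, g c * ∏ b ∈ Finset.univ.erase c, (x * d - h b) := by
    simp [hP, Polynomial.eval_finsetSum, Polynomial.eval_prod, mul_comm d]
  have hdeg : P.degree < (Finset.range n).card := by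
    rw [Finset.card_range]
    refine lt_of_le_of_lt (b := ((n - 1 : ℕ) : WithBot ℕ)) ?_ (by exact_mod_cast (by omega))
    refine Polynomial.degree_le_of_natDegree_le (Polynomial.natDegree_sum_le_of_forall_le _ _
      fun c _ => (Polynomial.natDegree_C_mul_le _ _).trans ?_)
    refine (Polynomial.natDegree_prod_le _ _).trans ?_
    refine (Finset.sum_le_card_nsmul _ _ 1 fun b _ => ?_).trans (by simp [hn])
    compute_degree
  have hinj : Set.InjOn (fun t : ℕ => (t : ℂ)) (Finset.range n) := Nat.cast_injective.injOn
  have key := congrArg (Polynomial.eval (h c₀ / d)) (Lagrange.eq_interpolate hinj hdeg)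
  rw [heval, Lagrange.interpolate_apply, Polynomial.eval_finsetSum,
    div_mul_cancel₀ _ hd, Finset.sum_eq_single c₀] at key
  · rw [key, Finset.mul_sum]
    refine Finset.sum_congr rfl fun t ht => ?_
    rw [Polynomial.eval_mul, Polynomial.eval_C, heval, mul_left_comm]
    congr 1
    -- Each of the n - 1 factors of the Lagrange basis polynomial absorbs one factor `d`, which
    -- clears its denominator.
    have hcard : n - 1 = ((Finset.range n).erase t).card := by
      rw [Finset.card_erase_of_mem ht, Finset.card_range]
    rw [hcard, ← Finset.prod_const, Lagrange.basis, Polynomial.eval_prod, ← Finset.prod_mul_distrib]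
    refine Finset.prod_congr rfl fun s hs => ?_
    simp only [Lagrange.basisDivisor, Polynomial.eval_mul, Polynomial.eval_C, Polynomial.eval_sub,
      Polynomial.eval_X]
    push_cast
    field_simp
  -- At `h c₀ / d` every term with c ≠ c₀ contains the vanishing factor b = c₀.
  · intro c _ hc
    rw [Finset.prod_eq_zero (i := c₀) (by simp [hc.symm]) (sub_self _), mul_zero]
  · simp

/-! ### Translates by representatives of cosets -/

section Coset

variable {Γ : Subgroup SL(2, ℤ)} {k l : ℤ}

/-- The translates of a form of level `Γ` by the elements of `SL(2, ℤ)`, which depend on a coset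
only. -/
def cosetTranslate (Γ : Subgroup SL(2, ℤ)) (k : ℤ) (f : ℍ → ℂ) (c : SL(2, ℤ) ⧸ Γ) : ℍ → ℂ :=
  f ∣[k] c.out⁻¹

variable {F : Type*} [FunLike F ℍ ℂ] [ModularFormClass F (Γ : Subgroup (GL (Fin 2) ℝ)) k] (f : F)

include k in
lemma slash_of_mem {γ : SL(2, ℤ)} (hγ : γ ∈ Γ) : (f : ℍ → ℂ) ∣[k] γ = f :=
  SlashInvariantFormClass.slash_action_eq f _ ⟨γ, hγ, rfl⟩

lemma cosetTranslate_mk (γ : SL(2, ℤ)) : cosetTranslate Γ k f γ = (f : ℍ → ℂ) ∣[k] γ⁻¹ := by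
  obtain ⟨δ, hδ⟩ := QuotientGroup.mk_out_eq_mul Γ γ
  rw [cosetTranslate, hδ, _root_.mul_inv_rev, SlashAction.slash_mul, slash_of_mem f (inv_mem δ.2)]

lemma cosetTranslate_one : cosetTranslate Γ k f ((1 : SL(2, ℤ)) : SL(2, ℤ) ⧸ Γ) = f := by
  rw [cosetTranslate_mk, inv_one, SlashAction.slash_one]

lemma cosetTranslate_slash (c : SL(2, ℤ) ⧸ Γ) (s : SL(2, ℤ)) :
    cosetTranslate Γ k f c ∣[k] s = cosetTranslate Γ k f (s⁻¹ • c) := by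
  induction c using QuotientGroup.induction_on with
  | H γ =>
    rw [MulAction.Quotient.smul_coe, cosetTranslate_mk, cosetTranslate_mk, smul_eq_mul,
      _root_.mul_inv_rev, inv_inv, SlashAction.slash_mul]

lemma mdifferentiable_cosetTranslate (c : SL(2, ℤ) ⧸ Γ) : MDiff (cosetTranslate Γ k f c) :=
  (ModularFormClass.holo f).slash k _

lemma isBoundedAtImInfty_cosetTranslate [Γ.FiniteIndex] (c : SL(2, ℤ) ⧸ Γ) :
    IsBoundedAtImInfty (cosetTranslate Γ k f c) :=
  ModularFormClass.bdd_at_infty_slash f _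

open Classical in
/-- The trace to level one of `f * ∏ (t * D - h')`, where `h'` runs through the translates of `h`
other than `h` itself. -/
lemma exists_levelOne_trace [Γ.FiniteIndex] [Fintype (SL(2, ℤ) ⧸ Γ)]
    {H : Type*} [FunLike H ℍ ℂ] [ModularFormClass H (Γ : Subgroup (GL (Fin 2) ℝ)) l]
    (h : H) (D : ModularForm 𝒮ℒ l) (t : ℂ) :
    ∃ B : ModularForm 𝒮ℒ (k + l * (Fintype.card (SL(2, ℤ) ⧸ Γ) - 1 : ℕ)),
      ∀ τ, B τ = ∑ c, cosetTranslate Γ k f c τ *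
        ∏ b ∈ Finset.univ.erase c, (t * D τ - cosetTranslate Γ l h b τ) := by
  set φ : ℍ → ℂ := ∑ c, cosetTranslate Γ k f c *
    ∏ b ∈ Finset.univ.erase c, (t • (D : ℍ → ℂ) - cosetTranslate Γ l h b) with hφ
  -- Slashing by `s` fixes `D` and permutes the cosets, hence permutes the summands.
  have hslash (s : SL(2, ℤ)) :
      φ ∣[k + l * (Fintype.card (SL(2, ℤ) ⧸ Γ) - 1 : ℕ)] s = φ := by
    have hD : (D : ℍ → ℂ) ∣[l] s = D := SlashInvariantFormClass.slash_action_eq D _ ⟨s, rfl⟩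
    have hfac (b) : (t • (D : ℍ → ℂ) - cosetTranslate Γ l h b) ∣[l] s =
        t • (D : ℍ → ℂ) - cosetTranslate Γ l h (s⁻¹ • b) := by
      rw [sub_eq_add_neg, SlashAction.add_slash, SlashAction.neg_slash, ModularForm.SL_smul_slash,
        hD, cosetTranslate_slash, ← sub_eq_add_neg]
    have hprod (c : SL(2, ℤ) ⧸ Γ) : (∏ b ∈ Finset.univ.erase c,
        (t • (D : ℍ → ℂ) - cosetTranslate Γ l h b))
          ∣[l * (Fintype.card (SL(2, ℤ) ⧸ Γ) - 1 : ℕ)] s =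
        ∏ b ∈ Finset.univ.erase (s⁻¹ • c), (t • (D : ℍ → ℂ) - cosetTranslate Γ l h b) := by
      have hcard : Fintype.card (SL(2, ℤ) ⧸ Γ) - 1 = (Finset.univ.erase c).card := by simp
      rw [hcard, ModularForm.SL_slash, ModularForm.prod_slash]
      simp only [← ModularForm.SL_slash, hfac]
      have hdet : Matrix.GeneralLinearGroup.det (Matrix.SpecialLinearGroup.toGL
          (Matrix.SpecialLinearGroup.map (Int.castRingHom ℝ) s)) = 1 :=
        Matrix.SpecialLinearGroup.det_mapGL s
      rw [hdet, Units.val_one, abs_one, _root_.one_zpow, one_smul]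
      refine Finset.prod_bij (fun b _ => s⁻¹ • b) ?_ ?_ ?_ ?_
      · simp
      · simp
      · intro b hb
        exact ⟨s • b, by simpa [smul_eq_iff_eq_inv_smul] using hb, by simp⟩
      · simp
    rw [hφ, SlashAction.sum_slash]
    simp only [ModularForm.mul_slash_SL2, cosetTranslate_slash, hprod]
    exact Equiv.sum_comp (MulAction.toPerm s⁻¹) fun c => cosetTranslate Γ k f c *
      ∏ b ∈ Finset.univ.erase c, (t • (D : ℍ → ℂ) - cosetTranslate Γ l h b)
  refine ⟨⟨⟨φ, ?_⟩, ?_, ?_⟩, fun τ => ?_⟩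
  · rintro _ ⟨s, rfl⟩
    exact hslash s
  · refine MDifferentiable.sum fun c _ => (mdifferentiable_cosetTranslate f c).mul
      (MDifferentiable.prod fun b _ => ?_)
    exact ((ModularFormClass.holo D).const_smul t).sub (mdifferentiable_cosetTranslate h b)
  · intro c hc
    rw [OnePoint.isBoundedAt_iff_forall_SL2Z hc]
    intro s _
    change IsBoundedAtImInfty (φ ∣[_] s)
    rw [hslash s]
    refine (Filter.boundedFilterSubalgebra ℂ atImInfty).sum_mem fun c _ =>
      (Filter.boundedFilterSubalgebra ℂ atImInfty).mul_mem (isBoundedAtImInfty_cosetTranslate f c)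
      ?_
    refine Filter.BoundedAtFilter.prod _ fun b _ => ?_
    rw [sub_eq_add_neg]
    exact (Filter.BoundedAtFilter.smul t (ModularFormClass.bdd_at_infty D)).add
      (isBoundedAtImInfty_cosetTranslate h b).neg
  · change φ τ = _
    simp [hφ]

end Coset

end

/-! ### The form Δ(Nτ) and its stabilizer in SL(2, ℤ). -/

section

open scoped Manifold
open Filter Asymptotics

/-! ### Upper triangular matrices -/

/-- The matrix `(a, b; 0, d)`. -/
def upperGL (a b d : ℤ) (ha : 0 < a) (hd : 0 < d) : GL (Fin 2) ℝ :=
  .mkOfDetNeZero !![(a : ℝ), b; 0, d] (by simp [ha.ne', hd.ne'])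

section upperGL

variable {a b d : ℤ} (ha : 0 < a) (hd : 0 < d)

lemma coe_upperGL : (upperGL a b d ha hd : Matrix (Fin 2) (Fin 2) ℝ) = !![(a : ℝ), b; 0, d] := rfl

lemma det_upperGL : (upperGL a b d ha hd).det.val = a * d := by
  simp [coe_upperGL]

lemma det_upperGL_pos : 0 < (upperGL a b d ha hd).det.val := by
  rw [det_upperGL]
  exact_mod_cast mul_pos ha hd

lemma coe_upperGL_smul (τ : ℍ) : ((upperGL a b d ha hd • τ : ℍ) : ℂ) = (a * τ + b) / d := by
  rw [coe_smul_of_det_pos (det_upperGL_pos ha hd)]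
  simp [num, denom, coe_upperGL]

lemma im_upperGL_smul (τ : ℍ) : (upperGL a b d ha hd • τ : ℍ).im = a / d * τ.im := by
  rw [← UpperHalfPlane.coe_im, coe_upperGL_smul, ← Complex.ofReal_intCast d, Complex.div_ofReal_im]
  simp
  ring

lemma slash_upperGL_apply (k : ℤ) (φ : ℍ → ℂ) (τ : ℍ) : (φ ∣[k] upperGL a b d ha hd) τ =
    (((a * d) ^ (k - 1) * d ^ (-k) : ℚ) : ℂ) * φ (upperGL a b d ha hd • τ) := by
  have h0 : (0 : ℝ) < a * d := by exact_mod_cast mul_pos ha hd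
  rw [ModularForm.slash_apply, det_upperGL, abs_of_pos h0, UpperHalfPlane.σ,
    if_pos (det_upperGL_pos ha hd)]
  simp [denom, coe_upperGL]
  ring

end upperGL

/-- The matrix `(d, 0; 0, 1)`. -/
def scaleGL (d : ℕ) [NeZero d] : GL (Fin 2) ℝ :=
  upperGL d 0 1 (by exact_mod_cast Nat.pos_of_ne_zero (NeZero.ne d)) one_pos

lemma coe_scaleGL_smul (d : ℕ) [NeZero d] (τ : ℍ) : ((scaleGL d • τ : ℍ) : ℂ) = d * τ := by
  rw [scaleGL, coe_upperGL_smul]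
  simp

lemma slash_scaleGL_apply (d : ℕ) [NeZero d] (k : ℤ) (φ : ℍ → ℂ) (τ : ℍ) :
    (φ ∣[k] scaleGL d) τ = (d : ℂ) ^ (k - 1) * φ (scaleGL d • τ) := by
  rw [scaleGL, slash_upperGL_apply]
  simp

lemma coe_mapGL (γ : SL(2, ℤ)) :
    ((Matrix.SpecialLinearGroup.mapGL ℝ γ : GL (Fin 2) ℝ) : Matrix (Fin 2) (Fin 2) ℝ) =
      !![(γ 0 0 : ℝ), γ 0 1; γ 1 0, γ 1 1] := by
  ext i j
  fin_cases i <;> fin_cases j <;> simp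

lemma coe_scalar_fin_two (c : ℝˣ) :
    (Matrix.GeneralLinearGroup.scalar (Fin 2) c : Matrix (Fin 2) (Fin 2) ℝ) =
      !![(c : ℝ), 0; 0, c] := by
  change Matrix.scalar (Fin 2) (c : ℝ) = _
  rw [Matrix.scalar_apply]
  ext i j
  fin_cases i <;> fin_cases j <;> rfl

lemma exists_SL2Z_entries {p q r s : ℤ} (h : p * s - q * r = 1) :
    ∃ γ : SL(2, ℤ), γ 0 0 = p ∧ γ 0 1 = q ∧ γ 1 0 = r ∧ γ 1 1 = s :=
  ⟨⟨!![p, q; r, s], by rwa [Matrix.det_fin_two_of]⟩, rfl, rfl, rfl, rfl⟩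

lemma slash_mapGL (k : ℤ) (φ : ℍ → ℂ) (γ : SL(2, ℤ)) :
    φ ∣[k] (Matrix.SpecialLinearGroup.mapGL ℝ γ : GL (Fin 2) ℝ) = φ ∣[k] γ := rfl

/-- The first column (N γ₀₀, γ₁₀) of the product is g times a primitive vector (p, r), where g is
the gcd. Bézout completes (p, r) to γ'; then a = g and d = N / g, so d = 1 exactly when N divides
γ₁₀. -/
lemma exists_scaleGL_mul_eq (N : ℕ) [NeZero N] (γ : SL(2, ℤ)) :
    ∃ (γ' : SL(2, ℤ)) (a b d : ℤ) (ha : 0 < a) (hd : 0 < d), a * d = N ∧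
      ((N : ℤ) ∣ γ 1 0 ↔ d = 1) ∧
        scaleGL N * Matrix.SpecialLinearGroup.mapGL ℝ γ =
          Matrix.SpecialLinearGroup.mapGL ℝ γ' * upperGL a b d ha hd := by
  have hN : (N : ℤ) ≠ 0 := by exact_mod_cast NeZero.ne N
  have hNpos : (0 : ℤ) < N := by positivity
  have hdet : γ 0 0 * γ 1 1 - γ 0 1 * γ 1 0 = 1 := by
    rw [← Matrix.det_fin_two]; exact γ.2
  obtain ⟨p, hp⟩ := Int.gcd_dvd_left (N * γ 0 0) (γ 1 0)
  obtain ⟨r, hr⟩ := Int.gcd_dvd_right (N * γ 0 0) (γ 1 0)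
  have hbez := Int.gcd_eq_gcd_ab (N * γ 0 0) (γ 1 0)
  set g : ℤ := (Int.gcd (N * γ 0 0) (γ 1 0) : ℤ) with hg
  set u := Int.gcdA (N * γ 0 0) (γ 1 0)
  set v := Int.gcdB (N * γ 0 0) (γ 1 0)
  have hgd : g * (p * γ 1 1 - r * N * γ 0 1) = N := by
    linear_combination (-γ 1 1) * hp + N * γ 0 1 * hr + N * hdet
  have hg0 : 0 < g := by
    refine lt_of_le_of_ne (by positivity) fun h => hN ?_
    rw [← hgd, ← h, zero_mul]
  have hd0 : 0 < p * γ 1 1 - r * N * γ 0 1 := by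
    exact pos_of_mul_pos_right (lt_of_lt_of_eq hNpos hgd.symm) hg0.le
  have hpr : p * u + r * v = 1 := by
    have : g * (p * u + r * v) = g * 1 := by linear_combination (-u) * hp - v * hr - hbez
    exact mul_left_cancel₀ hg0.ne' this
  obtain ⟨γ', e00, e01, e10, e11⟩ := exists_SL2Z_entries (p := p) (q := -v) (r := r) (s := u)
    (by linear_combination hpr)
  refine ⟨γ', g,
    u * N * γ 0 1 + v * γ 1 1, p * γ 1 1 - r * N * γ 0 1, hg0, hd0, hgd, ⟨fun h => ?_, fun h => ?_⟩,
    ?_⟩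
  · have hNg : (N : ℤ) ∣ g := Int.dvd_coe_gcd (dvd_mul_right _ _) h
    obtain ⟨e, he⟩ := hNg
    refine Int.eq_one_of_dvd_one hd0.le ⟨e, ?_⟩
    refine mul_left_cancel₀ hN ?_
    linear_combination (-1 : ℤ) * hgd + (p * γ 1 1 - r * N * γ 0 1) * he
  · rw [h, mul_one] at hgd
    rw [← hgd]
    exact Int.gcd_dvd_right _ _
  · have h1 : (γ 0 1 : ℝ) * N = p * ((u * N * γ 0 1 + v * γ 1 1 : ℤ) : ℝ)
        + -v * ((p * γ 1 1 - r * N * γ 0 1 : ℤ) : ℝ) := by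
      have : γ 0 1 * N = p * (u * N * γ 0 1 + v * γ 1 1) + -v * (p * γ 1 1 - r * N * γ 0 1) := by
        linear_combination (-N * γ 0 1) * hpr
      exact_mod_cast this
    have h2 : (γ 1 1 : ℝ) = r * ((u * N * γ 0 1 + v * γ 1 1 : ℤ) : ℝ)
        + u * ((p * γ 1 1 - r * N * γ 0 1 : ℤ) : ℝ) := by
      have : γ 1 1 = r * (u * N * γ 0 1 + v * γ 1 1) + u * (p * γ 1 1 - r * N * γ 0 1) := by
        linear_combination (-γ 1 1) * hpr
      exact_mod_cast this
    have h3 : (N : ℝ) * γ 0 0 = g * p := by exact_mod_cast hp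
    have h4 : (γ 1 0 : ℝ) = g * r := by exact_mod_cast hr
    refine Units.ext ?_
    rw [Matrix.GeneralLinearGroup.coe_mul, Matrix.GeneralLinearGroup.coe_mul, scaleGL, coe_upperGL,
      coe_upperGL, coe_mapGL, coe_mapGL, Matrix.mul_fin_two, Matrix.mul_fin_two]
    push_cast at h1 h2
    rw [e00, e01, e10, e11]
    ext i j
    fin_cases i <;> fin_cases j <;> simp
    · linear_combination h3
    · linear_combination h1
    · linear_combination h4
    · linear_combination h2

/-! ### The discriminant at `N τ` -/

lemma discriminant_slash (γ : SL(2, ℤ)) :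
    ModularForm.discriminant ∣[(12 : ℤ)] γ = ModularForm.discriminant :=
  SlashInvariantFormClass.slash_action_eq CuspForm.discriminant _ ⟨γ, rfl⟩

lemma exists_discriminant_slash_scaleGL_slash (N : ℕ) [NeZero N] (γ : SL(2, ℤ)) :
    ∃ (a b d : ℤ) (ha : 0 < a) (hd : 0 < d), a * d = N ∧ ((N : ℤ) ∣ γ 1 0 ↔ d = 1) ∧
      (ModularForm.discriminant ∣[(12 : ℤ)] scaleGL N) ∣[(12 : ℤ)] γ =
        ModularForm.discriminant ∣[(12 : ℤ)] upperGL a b d ha hd := by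
  obtain ⟨γ', a, b, d, ha, hd, hN, hdvd, hmul⟩ := exists_scaleGL_mul_eq N γ
  refine ⟨a, b, d, ha, hd, hN, hdvd, ?_⟩
  rw [← slash_mapGL, ← SlashAction.slash_mul, hmul, SlashAction.slash_mul, slash_mapGL,
    discriminant_slash]

lemma mem_Gamma0_iff_dvd {N : ℕ} {γ : SL(2, ℤ)} : γ ∈ Gamma0 N ↔ (N : ℤ) ∣ γ 1 0 := by
  rw [Gamma0_mem, ZMod.intCast_zmod_eq_zero_iff_dvd]

/-- The form `Δ (N τ)`, up to a constant factor. -/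
def scaledDiscriminant (N : ℕ) [NeZero N] :
    ModularForm (Gamma0 N : Subgroup (GL (Fin 2) ℝ)) 12 where
  toFun := ModularForm.discriminant ∣[(12 : ℤ)] scaleGL N
  slash_action_eq' := by
    rintro _ ⟨γ, hγ, rfl⟩
    obtain ⟨a, b, d, ha, hd, hN, hdvd, h⟩ := exists_discriminant_slash_scaleGL_slash N γ
    refine Eq.trans h ?_
    obtain rfl : d = 1 := hdvd.mp (mem_Gamma0_iff_dvd.mp hγ)
    obtain rfl : a = N := by simpa using hN
    have : upperGL N b 1 ha hd =
        Matrix.SpecialLinearGroup.mapGL ℝ (ModularGroup.T ^ b) * scaleGL N := by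
      refine Units.ext ?_
      rw [Matrix.GeneralLinearGroup.coe_mul, scaleGL, coe_upperGL, coe_upperGL, coe_mapGL,
        Matrix.mul_fin_two]
      simp [ModularGroup.coe_T_zpow]
    rw [this, SlashAction.slash_mul, slash_mapGL, discriminant_slash]
  holo' := (ModularFormClass.holo CuspForm.discriminant).slash 12 _
  bdd_at_cusps' {c} hc := by
    rw [Subgroup.IsArithmetic.isCusp_iff_isCusp_SL2Z] at hc
    rw [OnePoint.isBoundedAt_iff_forall_SL2Z hc]
    intro γ _
    obtain ⟨a, b, d, ha, hd, hN, hdvd, h⟩ := exists_discriminant_slash_scaleGL_slash N γ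
    rw [h]
    exact (ModularFormClass.bdd_at_infty CuspForm.discriminant).slash _ (by simp [coe_upperGL])

lemma scaledDiscriminant_apply (N : ℕ) [NeZero N] (τ : ℍ) : scaledDiscriminant N τ =
    (N : ℂ) ^ (11 : ℤ) * ModularForm.discriminant (scaleGL N • τ) :=
  slash_scaleGL_apply N 12 _ τ

/-- Decay at i∞ separates the two sides: the translate has order a/d in q, and a/d < N once d ≥ 2,
whereas Δ(Nτ) has order N. So the stabilizer of Δ(Nτ) is no larger than Γ₀(N). -/
lemma scaledDiscriminant_slash_ne (N : ℕ) [NeZero N] {γ : SL(2, ℤ)} (hγ : γ ∉ Gamma0 N) :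
    (scaledDiscriminant N : ℍ → ℂ) ∣[(12 : ℤ)] γ ≠ scaledDiscriminant N := by
  obtain ⟨a, b, d, ha, hd, hN, hdvd, h⟩ := exists_discriminant_slash_scaleGL_slash N γ
  intro heq
  have hd2 : 2 ≤ d := by
    have : d ≠ 1 := fun h1 => hγ (mem_Gamma0_iff_dvd.mpr (hdvd.mpr h1))
    omega
  have h' : ModularForm.discriminant ∣[(12 : ℤ)] upperGL a b d ha hd =
      ModularForm.discriminant ∣[(12 : ℤ)] scaleGL N := h.symm.trans heq
  have hlower : (fun τ : ℍ => Real.exp (-2 * π * (a / d * τ.im))) =O[atImInfty]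
      (ModularForm.discriminant ∣[(12 : ℤ)] upperGL a b d ha hd) := by
    have h1 := ModularForm.exp_isBigO_discriminant.comp_tendsto
      (tendsto_smul_atImInfty (g := upperGL a b d ha hd) (by simp [coe_upperGL]))
    have h2 : (fun τ : ℍ => Real.exp (-2 * π * (a / d * τ.im))) =O[atImInfty]
        (fun τ => ModularForm.discriminant (upperGL a b d ha hd • τ)) := by
      refine h1.congr_left fun τ => ?_
      simp [im_upperGL_smul]
    refine h2.trans ?_
    rw [funext (slash_upperGL_apply ha hd 12 ModularForm.discriminant)]
    refine isBigO_self_const_mul ?_ _ _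
    have := ha.ne'
    have := hd.ne'
    positivity
  have hupper : (ModularForm.discriminant ∣[(12 : ℤ)] scaleGL N) =O[atImInfty]
      fun τ : ℍ => Real.exp (-2 * π * (N * τ.im)) := by
    have h1 := (CuspFormClass.exp_decay_atImInfty (h := 1) CuspForm.discriminant one_pos
      one_mem_strictPeriods_SL).comp_tendsto (tendsto_smul_atImInfty (g := scaleGL N)
        (by simp [scaleGL, coe_upperGL]))
    rw [funext (slash_scaleGL_apply N 12 ModularForm.discriminant)]
    refine IsBigO.const_mul_left ?_ _
    refine h1.congr_right fun τ => ?_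
    simp [scaleGL, im_upperGL_smul]
  rw [h'] at hlower
  have hO := hlower.trans hupper
  have haN : (a : ℝ) / d < N := by
    have hd' : (2 : ℝ) ≤ d := by exact_mod_cast hd2
    have ha' : (0 : ℝ) < a := by exact_mod_cast ha
    have hN' : (a : ℝ) * d = N := by exact_mod_cast hN
    rw [div_lt_iff₀ (by linarith), ← hN']
    nlinarith
  have hlim : Tendsto (fun τ : ℍ => 2 * π * (N - a / d) * τ.im) atImInfty atTop :=
    tendsto_comap.const_mul_atTop (mul_pos (by positivity) (sub_pos.mpr haN))
  obtain ⟨C, hC⟩ := hO.bound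
  obtain ⟨τ, hτ, hτ'⟩ := (hC.and ((Real.tendsto_exp_atTop.comp hlim).eventually_gt_atTop C)).exists
  rw [Real.norm_of_nonneg (Real.exp_pos _).le, Real.norm_of_nonneg (Real.exp_pos _).le,
    ← div_le_iff₀ (Real.exp_pos _), ← Real.exp_sub] at hτ
  refine absurd hτ (not_le.mpr (lt_of_lt_of_eq hτ' ?_))
  simp only [Function.comp_apply]
  congr 1
  ring

end

/-! ### Lagrange combinations and their behaviour under Atkin-Lehner matrices. -/

section

open scoped Manifold

/-! ### Lagrange combinations -/

/-- The sum of the `B t`, `t < n`, with the homogenized Lagrange polynomials in `u`, `v` at the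
nodes `0, …, n - 1` as coefficients. -/
def lagrangeSum (n : ℕ) (B : ℕ → ℍ → ℂ) (u v : ℍ → ℂ) : ℍ → ℂ :=
  ∑ t ∈ Finset.range n, B t * ∏ s ∈ (Finset.range n).erase t,
    ((((t : ℚ) - s)⁻¹ : ℚ) : ℂ) • (u - ((s : ℚ) : ℂ) • v)

lemma lagrangeSum_apply (n : ℕ) (B : ℕ → ℍ → ℂ) (u v : ℍ → ℂ) (τ : ℍ) :
    lagrangeSum n B u v τ = ∑ t ∈ Finset.range n, B t τ * ∏ s ∈ (Finset.range n).erase t,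
      ((((t : ℚ) - s)⁻¹ : ℚ) : ℂ) * (u τ - s * v τ) := by
  simp [lagrangeSum]

/-- With integer nodes the Lagrange coefficients are rational, so `s` fixes them; this is why they
are written as casts from ℚ. -/
lemma AreConj.lagrangeSum {s : ℂ ≃+* ℂ} {n : ℕ} {B B' : ℕ → ℍ → ℂ} {u u' v v' : ℍ → ℂ}
    (hB : ∀ t, AreConj s (B t) (B' t)) (hu : AreConj s u u') (hv : AreConj s v v') :
    AreConj s (lagrangeSum n B u v) (lagrangeSum n B' u' v') :=
  .sum fun t _ => (hB t).mul (.prod fun i _ => (hu.sub (hv.ratCast_smul i)).ratCast_smul _)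

lemma mdifferentiable_lagrangeSum {n : ℕ} {B : ℕ → ℍ → ℂ} {u v : ℍ → ℂ}
    (hB : ∀ t, MDiff (B t)) (hu : MDiff u) (hv : MDiff v) : MDiff (lagrangeSum n B u v) :=
  MDifferentiable.sum fun t _ => (hB t).mul
    (MDifferentiable.prod fun _ _ => (hu.sub (hv.const_smul _)).const_smul _)

/-- The Lagrange factors are homogeneous of degree n - 1 in (u, v). -/
lemma lagrangeSum_eq_mul {n : ℕ} {B B' : ℕ → ℍ → ℂ} {u u' v v' : ℍ → ℂ} {σ τ : ℍ} {a b : ℂ}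
    (hB : ∀ t, B t σ = a * B' t τ) (hu : u σ = b * u' τ) (hv : v σ = b * v' τ) :
    lagrangeSum n B u v σ = a * b ^ (n - 1) * lagrangeSum n B' u' v' τ := by
  rw [lagrangeSum_apply, lagrangeSum_apply, Finset.mul_sum]
  refine Finset.sum_congr rfl fun t ht => ?_
  have hcard : n - 1 = ((Finset.range n).erase t).card := by
    rw [Finset.card_erase_of_mem ht, Finset.card_range]
  rw [hcard, ← Finset.prod_const, mul_mul_mul_comm, ← Finset.prod_mul_distrib, hB, hu, hv]
  congr 1
  refine Finset.prod_congr rfl fun s _ => ?_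
  ring

/-! ### Atkin-Lehner matrices -/

lemma levelOne_apply_smul {k : ℤ} (B : ModularForm 𝒮ℒ k) (γ : SL(2, ℤ)) (τ : ℍ) :
    B (γ • τ) = ((γ 1 0 : ℂ) * τ + γ 1 1) ^ k * B τ :=
  (ModularForm.slash_action_eq'_iff k B γ τ).mp
    (congrFun (SlashInvariantFormClass.slash_action_eq B _ ⟨γ, rfl⟩) τ)

section AtkinLehner

variable {N Q : ℕ} {W : GL (Fin 2) ℝ}

lemma IsAtkinLehnerMatrix.det_eq (hW : IsAtkinLehnerMatrix N Q W) : W.det.val = Q := by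
  obtain ⟨x, y, z, w, hdet, hW⟩ := hW
  rw [Matrix.GeneralLinearGroup.val_det_apply, hW, Matrix.det_fin_two_of]
  exact_mod_cast hdet

lemma IsAtkinLehnerMatrix.det_pos [NeZero Q] (hW : IsAtkinLehnerMatrix N Q W) :
    0 < W.det.val := by
  rw [hW.det_eq]
  exact_mod_cast Nat.pos_of_ne_zero (NeZero.ne Q)

lemma IsAtkinLehnerMatrix.slash_two_apply [NeZero Q] (hW : IsAtkinLehnerMatrix N Q W)
    (φ : ℍ → ℂ) (τ : ℍ) : (φ ∣[(2 : ℤ)] W) τ = Q * φ (W • τ) * (denom W τ ^ 2)⁻¹ := by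
  rw [ModularForm.slash_apply, UpperHalfPlane.σ, if_pos hW.det_pos, hW.det_eq,
    abs_of_nonneg (by positivity)]
  norm_num
  exact mul_comm _ _

/-- A form of level one at `W τ`. -/
lemma IsAtkinLehnerMatrix.levelOne_apply [NeZero Q] (hQN : Q ∣ N)
    (hW : IsAtkinLehnerMatrix N Q W) {k : ℤ} (B : ModularForm 𝒮ℒ k) (τ : ℍ) :
    B (W • τ) = denom W τ ^ k * B (scaleGL Q • τ) := by
  obtain ⟨M, rfl⟩ := hQN
  obtain ⟨x, y, z, w, hdet, hW⟩ := hW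
  have hQ : (Q : ℤ) ≠ 0 := by exact_mod_cast NeZero.ne Q
  obtain ⟨γ, e00, e01, e10, e11⟩ := exists_SL2Z_entries (p := x) (q := y) (r := M * z) (s := Q * w)
    (mul_left_cancel₀ hQ (by push_cast at hdet; linear_combination hdet))
  have hmul : W = Matrix.SpecialLinearGroup.mapGL ℝ γ * scaleGL Q := by
    refine Units.ext ?_
    rw [Matrix.GeneralLinearGroup.coe_mul, hW, scaleGL, coe_upperGL, coe_mapGL, e00, e01, e10, e11,
      Matrix.mul_fin_two]
    push_cast
    congr! 3 <;> simp <;> ring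
  have hden : denom W τ = (γ 1 0 : ℂ) * (scaleGL Q • τ : ℍ) + γ 1 1 := by
    rw [coe_scaleGL_smul, e10, e11]
    simp [denom, hW]
    ring
  rw [hden, ← levelOne_apply_smul, hmul, mul_smul]
  rfl

/-- With γ = (Qx, My; z, w) one has diag(N, 1) W = Q γ diag(M, 1). The constant is (QM)¹¹ / Q¹²; its
rationality is what conjugation needs. -/
lemma IsAtkinLehnerMatrix.scaledDiscriminant_apply [NeZero N] [NeZero Q] {M : ℕ}
    [NeZero M] (hN : N = Q * M) (hW : IsAtkinLehnerMatrix N Q W) (τ : ℍ) :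
    scaledDiscriminant N (W • τ) =
      denom W τ ^ 12 * (((M ^ 11 / Q : ℚ) : ℂ) * ModularForm.discriminant (scaleGL M • τ)) := by
  subst hN
  obtain ⟨x, y, z, w, hdet, hW⟩ := hW
  have hQ : (Q : ℤ) ≠ 0 := by exact_mod_cast NeZero.ne Q
  have hQ' : (Q : ℂ) ≠ 0 := by exact_mod_cast NeZero.ne Q
  obtain ⟨γ, e00, e01, e10, e11⟩ := exists_SL2Z_entries (p := Q * x) (q := M * y) (r := z) (s := w)
    (mul_left_cancel₀ hQ (by push_cast at hdet; linear_combination hdet))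
  have hmul : scaleGL (Q * M) * W = Matrix.GeneralLinearGroup.scalar (Fin 2)
      (Units.mk0 (Q : ℝ) (by exact_mod_cast NeZero.ne Q)) *
        (Matrix.SpecialLinearGroup.mapGL ℝ γ * scaleGL M) := by
    refine Units.ext ?_
    rw [Matrix.GeneralLinearGroup.coe_mul, Matrix.GeneralLinearGroup.coe_mul,
      Matrix.GeneralLinearGroup.coe_mul, coe_scalar_fin_two, hW, scaleGL,
      scaleGL, coe_upperGL, coe_upperGL, coe_mapGL, e00, e01, e10, e11]
    ext i j
    fin_cases i <;> fin_cases j <;> simp <;> ring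
  have hden : denom W τ = Q * ((γ 1 0 : ℂ) * (scaleGL M • τ : ℍ) + γ 1 1) := by
    rw [coe_scaleGL_smul, e10, e11]
    simp [denom, hW]
    ring
  have hΔ := levelOne_apply_smul (ModularFormClass.modularForm CuspForm.discriminant) γ
    (scaleGL M • τ)
  change ModularForm.discriminant _ = _ * ModularForm.discriminant _ at hΔ
  rw [KleinianMock.scaledDiscriminant_apply, ← mul_smul, hmul, mul_smul, glScalar_smul, mul_smul]
  change _ * ModularForm.discriminant (γ • scaleGL M • τ) = _
  rw [hΔ, hden]
  push_cast
  have : (Q * M : ℂ) ^ (11 : ℤ) = Q ^ 11 * M ^ 11 := by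
    rw [← mul_pow]; norm_cast
  rw [this, show ((12 : ℤ)) = ((12 : ℕ) : ℤ) by rfl, zpow_natCast]
  field_simp

end AtkinLehner

end

section

open scoped Manifold

/-! ### Eigenvalues of newforms and of their conjugates -/

section Eigenvalue

variable {N Q : ℕ} {W : GL (Fin 2) ℝ}

lemma apply_smul_of_mem_Gamma0 {k : ℤ} {H : Type*} [FunLike H ℍ ℂ]
    [ModularFormClass H (Gamma0 N : Subgroup (GL (Fin 2) ℝ)) k] (f : H) {γ : SL(2, ℤ)}
    (hγ : γ ∈ Gamma0 N) (τ : ℍ) : f (γ • τ) = ((γ 1 0 : ℂ) * τ + γ 1 1) ^ k * f τ :=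
  (ModularForm.slash_action_eq'_iff k f γ τ).mp (congrFun (slash_of_mem (k := k) f hγ) τ)

/-- The square of an Atkin-Lehner matrix is `Q` times an element of `Γ₀(N)`. -/
lemma IsAtkinLehnerMatrix.exists_sq_eq [NeZero Q] (hQN : Q ∣ N)
    (hW : IsAtkinLehnerMatrix N Q W) : ∃ γ ∈ Gamma0 N, ∀ τ : ℍ, W • W • τ = γ • τ ∧
      denom W ↑(W • τ) * denom W τ = Q * ((γ 1 0 : ℂ) * τ + γ 1 1) := by
  obtain ⟨M, rfl⟩ := hQN
  have hpos := hW.det_pos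
  obtain ⟨x, y, z, w, hdet, hW⟩ := hW
  have hQ : (Q : ℤ) ≠ 0 := by exact_mod_cast NeZero.ne Q
  have h1 : (Q * x * w - M * y * z : ℤ) = 1 :=
    mul_left_cancel₀ hQ (by push_cast at hdet; linear_combination hdet)
  obtain ⟨γ, e00, e01, e10, e11⟩ := exists_SL2Z_entries (p := Q * x ^ 2 + M * y * z)
    (q := y * (x + w)) (r := Q * M * z * (x + w)) (s := M * y * z + Q * w ^ 2)
    (by linear_combination (Q * x * w - M * y * z + 1) * h1)
  have hmul : W * W = Matrix.GeneralLinearGroup.scalar (Fin 2)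
      (Units.mk0 (Q : ℝ) (by exact_mod_cast NeZero.ne Q)) *
        Matrix.SpecialLinearGroup.mapGL ℝ γ := by
    refine Units.ext ?_
    rw [Matrix.GeneralLinearGroup.coe_mul, Matrix.GeneralLinearGroup.coe_mul,
      coe_scalar_fin_two, hW, Units.val_mk0, coe_mapGL, e00, e01, e10, e11]
    ext i j
    fin_cases i <;> fin_cases j <;> simp <;> ring
  refine ⟨γ, mem_Gamma0_iff_dvd.mpr ⟨z * (x + w), by rw [e10]; push_cast; ring⟩, fun τ => ⟨?_, ?_⟩⟩
  · rw [← mul_smul, hmul, mul_smul, glScalar_smul]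
    rfl
  · have hne : denom W τ ≠ 0 := denom_ne_zero W τ
    rw [e10, e11, denom, coe_smul_of_det_pos hpos, num]
    rw [denom] at hne ⊢
    rw [add_mul, mul_assoc, div_mul_cancel₀ _ hne]
    simp [hW]
    ring

lemma IsAtkinLehnerMatrix.apply_smul [NeZero Q] (hW : IsAtkinLehnerMatrix N Q W) {φ : ℍ → ℂ}
    {lam : ℂ} (hlam : φ ∣[(2 : ℤ)] W = lam • φ) (τ : ℍ) :
    φ (W • τ) = lam * (Q : ℂ)⁻¹ * denom W τ ^ 2 * φ τ := by
  have h := congrFun hlam τ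
  have hQ : (Q : ℂ) ≠ 0 := by exact_mod_cast NeZero.ne Q
  have hne : denom W τ ≠ 0 := denom_ne_zero W τ
  rw [hW.slash_two_apply, Pi.smul_apply, smul_eq_mul] at h
  field_simp at h ⊢
  linear_combination h

/-- The eigenvalues of Atkin-Lehner involutions are signs. -/
theorem IsAtkinLehnerMatrix.eigenvalue_eq_one_or [NeZero Q] (hQN : Q ∣ N)
    (hW : IsAtkinLehnerMatrix N Q W) {f : S2 N} (hf : (f : ℍ → ℂ) ≠ 0) {lam : ℂ}
    (hlam : (f : ℍ → ℂ) ∣[(2 : ℤ)] W = lam • (f : ℍ → ℂ)) : lam = 1 ∨ lam = -1 := by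
  obtain ⟨τ, hτ⟩ := Function.ne_iff.mp hf
  obtain ⟨γ, hγ, h⟩ := hW.exists_sq_eq hQN
  obtain ⟨h1, h2⟩ := h τ
  have key := apply_smul_of_mem_Gamma0 (k := 2) f hγ τ
  have hQ : (Q : ℂ) ≠ 0 := by exact_mod_cast NeZero.ne Q
  have hd : denom W ↑(W • τ) * denom W τ ≠ 0 :=
    mul_ne_zero (denom_ne_zero W _) (denom_ne_zero W _)
  -- Two applications of `W` give λ² where γ gives 1; the automorphy factors agree and cancel.
  rw [← h1, hW.apply_smul hlam, hW.apply_smul hlam] at key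
  have h3 : ((γ 1 0 : ℂ) * τ + γ 1 1) = denom W ↑(W • τ) * denom W τ / Q := by
    rw [h2]; field_simp
  rw [h3] at key
  rw [← sq_eq_one_iff]
  have h4 : (denom W ↑(W • τ) * denom W τ / Q) ^ 2 * f τ ≠ 0 :=
    mul_ne_zero (pow_ne_zero _ (div_ne_zero hd hQ)) hτ
  refine mul_right_cancel₀ h4 ?_
  norm_cast at key ⊢
  linear_combination key

end Eigenvalue

/-! ### Atkin-Lehner operators commute with Galois conjugation. -/

section Conjugates

open Classical in
/-- A form `f` for `Γ₀(N)` times the product of the differences of `Δ(N τ)` and its other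
translates is, up to a power of `Δ`, a combination of forms of level one. -/
lemma exists_mul_prod_eq_lagrangeSum {N : ℕ} [NeZero N] [Fintype (SL(2, ℤ) ⧸ Gamma0 N)] {k : ℤ}
    {H : Type*} [FunLike H ℍ ℂ]
    [ModularFormClass H (Gamma0 N : Subgroup (GL (Fin 2) ℝ)) k] (f : H) :
    ∃ B : ℕ → ModularForm 𝒮ℒ (k + 12 * (Fintype.card (SL(2, ℤ) ⧸ Gamma0 N) - 1 : ℕ)),
      lagrangeSum (Fintype.card (SL(2, ℤ) ⧸ Gamma0 N)) (fun t => B t) (scaledDiscriminant N)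
        ModularForm.discriminant =
      (fun τ => ModularForm.discriminant τ ^ (Fintype.card (SL(2, ℤ) ⧸ Gamma0 N) - 1)) *
        ((f : ℍ → ℂ) * ∏ b ∈ Finset.univ.erase ((1 : SL(2, ℤ)) : SL(2, ℤ) ⧸ Gamma0 N),
          ((scaledDiscriminant N : ℍ → ℂ) -
            cosetTranslate (Gamma0 N) 12 (scaledDiscriminant N) b)) := by
  choose B hB using fun t : ℕ => exists_levelOne_trace (Γ := Gamma0 N) (k := k) (l := 12) f
    (scaledDiscriminant N) (ModularFormClass.modularForm CuspForm.discriminant) t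
  refine ⟨B, funext fun τ => ?_⟩
  have := pow_mul_prod_sub_eq_sum (fun c => cosetTranslate (Gamma0 N) k f c τ)
    (fun c => cosetTranslate (Gamma0 N) 12 (scaledDiscriminant N) c τ)
    (ModularForm.discriminant_ne_zero τ) ((1 : SL(2, ℤ)) : SL(2, ℤ) ⧸ Gamma0 N)
  rw [cosetTranslate_one, cosetTranslate_one] at this
  rw [lagrangeSum_apply]
  simp only [Pi.mul_apply, Finset.prod_apply, Pi.sub_apply]
  rw [this]
  refine Finset.sum_congr rfl fun t _ => ?_
  rw [hB]
  rfl

/-- Holomorphic functions on ℍ have no zero divisors, and a vanishing factor would put a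
representative of a nontrivial coset in the stabilizer of Δ(Nτ). -/
lemma prod_scaledDiscriminant_sub_ne_zero {N : ℕ} [NeZero N] [Fintype (SL(2, ℤ) ⧸ Gamma0 N)]
    [DecidableEq (SL(2, ℤ) ⧸ Gamma0 N)] :
    ∏ b ∈ Finset.univ.erase ((1 : SL(2, ℤ)) : SL(2, ℤ) ⧸ Gamma0 N),
      ((scaledDiscriminant N : ℍ → ℂ) -
        cosetTranslate (Gamma0 N) 12 (scaledDiscriminant N) b) ≠ 0 := by
  rw [Ne, prod_eq_zero_iff fun b _ => (ModularFormClass.holo (scaledDiscriminant N)).sub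
    (mdifferentiable_cosetTranslate (k := 12) (scaledDiscriminant N) b)]
  rintro ⟨b, hb, h⟩
  refine scaledDiscriminant_slash_ne N (γ := b.out⁻¹) (fun hmem => ?_) (sub_eq_zero.mp h).symm
  refine (Finset.mem_erase.mp hb).1 ?_
  rw [← QuotientGroup.out_eq' b, QuotientGroup.eq, _root_.mul_one]
  exact hmem

/-- Once the powers of `denom W τ` are split off, what remains involves only τ ↦ Qτ and τ ↦ Mτ, that
is, q ↦ q^Q and q ↦ q^M, which are compatible with conjugation. -/
lemma lagrangeSum_atkinLehner {N Q : ℕ} [NeZero N] [NeZero Q] {M : ℕ} [NeZero M]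
    (hN : N = Q * M) {W : GL (Fin 2) ℝ} (hW : IsAtkinLehnerMatrix N Q W) {k : ℤ} (n : ℕ)
    (B : ℕ → ModularForm 𝒮ℒ k) (τ : ℍ) :
    lagrangeSum n (fun t => B t) (scaledDiscriminant N) ModularForm.discriminant (W • τ) =
      denom W τ ^ k * (denom W τ ^ 12) ^ (n - 1) *
        lagrangeSum n (fun t => (B t : ℍ → ℂ) ∘ (scaleGL Q • ·))
          (((M ^ 11 / Q : ℚ) : ℂ) • (ModularForm.discriminant ∘ (scaleGL M • ·)))
          (ModularForm.discriminant ∘ (scaleGL Q • ·)) τ := by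
  refine lagrangeSum_eq_mul (fun t => hW.levelOne_apply ⟨M, hN⟩ (B t) τ)
    (hW.scaledDiscriminant_apply hN τ) ?_
  exact hW.levelOne_apply ⟨M, hN⟩ (ModularFormClass.modularForm CuspForm.discriminant) τ

lemma mdifferentiable_discriminant : MDiff ModularForm.discriminant :=
  ModularFormClass.holo CuspForm.discriminant

lemma areConj_scaledDiscriminant (s : ℂ ≃+* ℂ) (N : ℕ) [NeZero N] :
    AreConj s (scaledDiscriminant N) (scaledDiscriminant N) := by
  have := ((areConj_discriminant s).expand (NeZero.ne N) (coe_scaleGL_smul N)).ratCast_smul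
    ((N : ℚ) ^ (11 : ℤ))
  convert! this using 1 <;>
  · ext τ
    rw [scaledDiscriminant_apply]
    simp

lemma areConj_of_fourierCoeff {N : ℕ} [NeZero N] {f g : S2 N} {s : ℂ ≃+* ℂ}
    (h : ∀ n, fourierCoeff g n = s (fourierCoeff f n)) : AreConj s f g := by
  have h1 : (1 : ℝ) ∈ (Gamma0 N : Subgroup (GL (Fin 2) ℝ)).strictPeriods := by simp
  refine ⟨_, hasQSeries_qExpansion f h1, ?_⟩
  convert! hasQSeries_qExpansion g h1 using 1
  ext n
  exact (h n).symm

/-- Galois conjugate forms have the same eigenvalue under an Atkin-Lehner involution, provided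
that it is a sign. -/
theorem slash_eq_of_isGaloisConjugate {N Q : ℕ} [NeZero N] [NeZero Q] (hQN : Q ∣ N)
    {W : GL (Fin 2) ℝ} (hW : IsAtkinLehnerMatrix N Q W) {f g : S2 N}
    (hfg : IsGaloisConjugate f g) {lam : ℂ} (hsign : lam = 1 ∨ lam = -1)
    (hlam : (f : ℍ → ℂ) ∣[(2 : ℤ)] W = lam • (f : ℍ → ℂ)) :
    (g : ℍ → ℂ) ∣[(2 : ℤ)] W = lam • (g : ℍ → ℂ) := by
  classical
  obtain ⟨s, hs⟩ := hfg
  have hconj := areConj_of_fourierCoeff hs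
  obtain ⟨M, hN⟩ := hQN
  have : NeZero M := ⟨fun h => NeZero.ne N (by rw [hN, h, mul_zero])⟩
  have : Fintype (SL(2, ℤ) ⧸ Gamma0 N) := Fintype.ofFinite _
  set n := Fintype.card (SL(2, ℤ) ⧸ Gamma0 N) with hn
  set u : ℍ → ℂ := ⇑(scaledDiscriminant N) with hu
  set v : ℍ → ℂ := ModularForm.discriminant with hv
  have hcu : AreConj s u u := areConj_scaledDiscriminant s N
  have hcv : AreConj s v v := areConj_discriminant s
  set u' : ℍ → ℂ := ((M ^ 11 / Q : ℚ) : ℂ) • (v ∘ (scaleGL M • ·)) with hu'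
  set v' : ℍ → ℂ := v ∘ (scaleGL Q • ·) with hv'
  have hcv' : AreConj s v' v' := hcv.expand (NeZero.ne Q) (coe_scaleGL_smul Q)
  have hcu' : AreConj s u' u' :=
    (hcv.expand (NeZero.ne M) (coe_scaleGL_smul M)).ratCast_smul _
  -- The constant form 1 yields the denominator: it produces the same product of differences as `f`,
  -- so the quotient of the two Lagrange sums is `f`.
  obtain ⟨A, hA⟩ := exists_mul_prod_eq_lagrangeSum (k := 0)
    (1 : ModularForm (Gamma0 N : Subgroup (GL (Fin 2) ℝ)) 0)
  obtain ⟨B, hB⟩ := exists_mul_prod_eq_lagrangeSum (k := 2) f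
  choose A' hA' using fun t => exists_areConj_levelOne s (3 + 12 * (n - 1))
    (0 + 12 * (n - 1 : ℕ)) (by push_cast; omega) (A t)
  choose B' hB' using fun t => exists_areConj_levelOne s (3 + 12 * (n - 1))
    (2 + 12 * (n - 1 : ℕ)) (by push_cast; omega) (B t)
  have hfA : (f : ℍ → ℂ) * lagrangeSum n (fun t => A t) u v = lagrangeSum n (fun t => B t) u v := by
    rw [hA, hB, ModularForm.one_coe_eq_one, one_mul]
    ring
  have hA0 : lagrangeSum n (fun t => A t) u v ≠ 0 := by
    rw [hA, ModularForm.one_coe_eq_one, one_mul]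
    obtain ⟨τ, hτ⟩ := Function.ne_iff.mp (prod_scaledDiscriminant_sub_ne_zero (N := N))
    exact fun h => mul_ne_zero (pow_ne_zero _ (ModularForm.discriminant_ne_zero τ)) hτ
      (congrFun h τ)
  have hcA := AreConj.lagrangeSum (n := n) hA' hcu hcv
  have hcB := AreConj.lagrangeSum (n := n) hB' hcu hcv
  have hgA : (g : ℍ → ℂ) * lagrangeSum n (fun t => A' t) u v =
      lagrangeSum n (fun t => B' t) u v := by
    refine (hconj.mul hcA).right_unique ?_
    rw [hfA]
    exact hcB
  have hA'0 : lagrangeSum n (fun t => A' t) u v ≠ 0 := fun h => by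
    rw [h] at hcA
    exact hA0 hcA.eq_zero
  set X : (ℕ → ℍ → ℂ) → ℍ → ℂ := fun C => lagrangeSum n (fun t => C t ∘ (scaleGL Q • ·)) u' v'
  have hX {C C' : ℕ → ℍ → ℂ} (h : ∀ t, AreConj s (C t) (C' t)) : AreConj s (X C) (X C') :=
    .lagrangeSum (fun t => (h t).expand (NeZero.ne Q) (coe_scaleGL_smul Q)) hcu' hcv'
  have hQ : (Q : ℂ) ≠ 0 := by exact_mod_cast NeZero.ne Q
  -- Evaluate the identity at Wτ and cancel the common automorphy factor; the weight difference 2 is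
  -- absorbed by the slash of φ.
  have twist {φ : ℍ → ℂ} {C : ℕ → ModularForm 𝒮ℒ (0 + 12 * ((n - 1 : ℕ) : ℤ))}
      {E : ℕ → ModularForm 𝒮ℒ (2 + 12 * ((n - 1 : ℕ) : ℤ))}
      (h : φ * lagrangeSum n (fun t => C t) u v = lagrangeSum n (fun t => E t) u v) :
      (Q : ℂ)⁻¹ • (φ ∣[(2 : ℤ)] W) * X (fun t => C t) = X (fun t => E t) := by
    ext τ
    have h1 := congrFun h (W • τ)
    have hd : denom W τ ≠ 0 := denom_ne_zero W τ
    rw [Pi.mul_apply, lagrangeSum_atkinLehner hN hW, lagrangeSum_atkinLehner hN hW,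
      zpow_add₀ hd, zpow_add₀ hd, zpow_zero, one_mul] at h1
    rw [Pi.mul_apply, Pi.smul_apply, hW.slash_two_apply, smul_eq_mul]
    change _ * lagrangeSum _ _ _ _ τ = lagrangeSum _ _ _ _ τ
    have hP : denom W τ ^ (12 * ((n - 1 : ℕ) : ℤ)) * (denom W τ ^ 12) ^ (n - 1) ≠ 0 :=
      mul_ne_zero (zpow_ne_zero _ hd) (pow_ne_zero _ (pow_ne_zero _ hd))
    have hd2 : denom W τ ^ (2 : ℤ) = denom W τ ^ 2 := by norm_cast
    rw [hd2] at h1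
    field_simp
    refine mul_left_cancel₀ hP ?_
    linear_combination h1
  have key1 := twist hfA
  have key2 := twist hgA
  rw [hlam] at key1
  -- This conjugates `key1`, using that `s` fixes the sign λ. Comparison with `key2` then leaves
  -- only the factor `X A'` to cancel.
  have key3 : (Q : ℂ)⁻¹ • lam • (g : ℍ → ℂ) * X (fun t => A' t) = X (fun t => B' t) := by
    refine AreConj.right_unique (s := s) ?_ (hX hB')
    rw [← key1]
    refine AreConj.mul ?_ (hX hA')
    have hl : s lam = lam := by rcases hsign with rfl | rfl <;> simp
    simpa [hl] using (hconj.smul lam).smul (Q : ℂ)⁻¹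
  have hXm : MDiff (X fun t => A' t) :=
    mdifferentiable_lagrangeSum
      (fun t => (ModularFormClass.holo (A' t)).comp (mdifferentiable_smul (det_upperGL_pos _ _)))
      ((mdifferentiable_discriminant.comp
        (mdifferentiable_smul (det_upperGL_pos _ _))).const_smul _)
      (mdifferentiable_discriminant.comp (mdifferentiable_smul (det_upperGL_pos _ _)))
  have hX0 : (X fun t => A' t) ≠ 0 := by
    obtain ⟨τ, hτ⟩ := Function.ne_iff.mp hA'0
    intro h
    refine hτ ?_
    -- `X A'` is, up to a nonvanishing factor, the nonzero denominator of `g` composed with `W`.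
    rw [← smul_inv_smul W τ, lagrangeSum_atkinLehner hN hW]
    have := congrFun h (W⁻¹ • τ)
    change lagrangeSum _ _ _ _ _ = _ at this
    rw [this]
    simp
  have hdiff : ((g : ℍ → ℂ) ∣[(2 : ℤ)] W - lam • (g : ℍ → ℂ)) * (X fun t => A' t) = 0 := by
    have h0 : (Q : ℂ)⁻¹ •
        (((g : ℍ → ℂ) ∣[(2 : ℤ)] W - lam • (g : ℍ → ℂ)) * (X fun t => A' t)) = 0 := by
      rw [← smul_mul_assoc, smul_sub, sub_mul, key2, key3, sub_self]
    exact (smul_eq_zero.mp h0).resolve_left (inv_ne_zero hQ)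
  rw [mul_eq_zero_iff (((ModularFormClass.holo g).slash 2 W).sub
    ((ModularFormClass.holo g).const_smul lam)) hXm] at hdiff
  exact sub_eq_zero.mp (hdiff.resolve_right hX0)

end Conjugates

end

/-! ### Eichler integrals through primitives, and their transformation under W. -/

section

open Filter Topology Asymptotics
open Function.Periodic (qParam)

/-! ### Eichler integrals -/

section Eichler

variable {N : ℕ} {g : S2 N}

lemma one_mem_strictPeriods_Gamma0 :
    (1 : ℝ) ∈ (Gamma0 N : Subgroup (GL (Fin 2) ℝ)).strictPeriods := by simp

/-- The derivative of τ ↦ Wτ is Q / `denom W τ` ^ 2, exactly the factor in the weight two slash, so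
the eigenvalue equation makes the derivative vanish. -/
lemma IsAtkinLehnerMatrix.exists_primitive_smul_sub_eq {Q : ℕ} [NeZero Q] {W : GL (Fin 2) ℝ}
    (hW : IsAtkinLehnerMatrix N Q W) {lam : ℂ}
    (hlam : (g : ℍ → ℂ) ∣[(2 : ℤ)] W = lam • (g : ℍ → ℂ)) {E : ℂ → ℂ}
    (hE : ∀ τ : ℍ, HasDerivAt E (2 * π * Complex.I * g τ) τ) :
    ∃ c, ∀ τ : ℍ, E ↑(W • τ) - lam * E τ = c := by
  have hderiv (τ : ℍ) :
      HasDerivAt (fun z : ℂ => E ↑(W • ofComplex z) - lam * E z) 0 τ := by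
    have h1 := (hasStrictDerivAt_smul (g := W) hW.det_pos τ).hasDerivAt
    have h2 := HasDerivAt.comp (τ : ℂ) (h₂ := E) (by rw [ofComplex_apply]; exact hE (W • τ)) h1
    convert! h2.sub ((hE τ).const_mul lam) using 1
    have hQ : (Q : ℂ) ≠ 0 := by exact_mod_cast NeZero.ne Q
    have hJ : denom W τ ≠ 0 := denom_ne_zero W τ
    have hdet : W.val.det = Q := hW.det_eq
    rw [hW.apply_smul hlam, hdet]
    push_cast
    field_simp
    ring
  have hopen : IsOpen {z : ℂ | 0 < z.im} := isOpen_upperHalfPlaneSet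
  obtain ⟨c, hc⟩ := hopen.exists_is_const_of_deriv_eq_zero
    (f := fun z : ℂ => E ↑(W • ofComplex z) - lam * E z)
    (convex_halfSpace_im_gt 0).isPreconnected
    (fun z hz => (hderiv ⟨z, hz⟩).differentiableAt.differentiableWithinAt)
    (fun z hz => (hderiv ⟨z, hz⟩).deriv)
  exact ⟨c, fun τ => by simpa using hc τ τ.im_pos⟩

lemma tendsto_ofComplex_vertical (w : ℂ) :
    Tendsto (fun t : ℝ => ofComplex (w + t * Complex.I)) atTop atImInfty := by
  refine tendsto_comap_im_ofComplex.comp (tendsto_comap_iff.mpr ?_)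
  simpa [Function.comp_def] using tendsto_atTop_add_const_left _ w.im tendsto_id

variable (g) in
lemma isBigO_exp_atImInfty : g =O[atImInfty] fun τ => Real.exp (-(2 * π) * τ.im) := by
  simpa using CuspFormClass.exp_decay_atImInfty g one_pos one_mem_strictPeriods_Gamma0

variable (g) in
lemma tendsto_im_sq_mul_atImInfty :
    Tendsto (fun τ : ℍ => (τ.im : ℂ) ^ 2 * g τ) atImInfty (𝓝 0) := by
  have h1 : Tendsto (fun y : ℝ => y ^ 2 * Real.exp (-(2 * π) * y)) atTop (𝓝 0) := by
    refine (isLittleO_pow_exp_pos_mul_atTop (k := 2) (b := 2 * π)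
      (by positivity)).tendsto_div_nhds_zero.congr fun y => ?_
    rw [neg_mul, Real.exp_neg, div_eq_mul_inv]
  have h2 : (fun τ : ℍ => (τ.im : ℂ) ^ 2) =O[atImInfty] fun τ => τ.im ^ 2 :=
    .of_bound 1 (by simp)
  exact (h2.mul (isBigO_exp_atImInfty g)).trans_tendsto (h1.comp tendsto_comap)

/-- Allowing `w` on the real axis treats base points in ℍ and finite cusps together. The limit `b`
serves only to give integrability at the lower end. -/
lemma integral_vertical_eq {E : ℂ → ℂ} (hE : ∀ τ : ℍ, HasDerivAt E (2 * π * Complex.I * g τ) τ)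
    (hE0 : Tendsto (fun τ : ℍ => E τ) atImInfty (𝓝 0)) {w : ℂ} (hw : 0 ≤ w.im) {m b : ℂ}
    (hm : Tendsto (fun t : ℝ => E (w + t * Complex.I)) (𝓝[>] 0) (𝓝 m))
    (hb : Tendsto (fun t : ℝ => onComplex g (w + t * Complex.I)) (𝓝[>] 0) (𝓝 b)) :
    -2 * π * Complex.I * ∫ t in Set.Ioi (0 : ℝ), onComplex g (w + t * Complex.I) * Complex.I =
      m := by
  have him {t : ℝ} (ht : 0 < t) : 0 < (w + t * Complex.I).im := by simpa using by linarith
  have hline (t : ℝ) : HasDerivAt (fun t : ℝ => w + t * Complex.I) Complex.I t := by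
    simpa using ((hasDerivAt_id t).ofReal_comp.mul_const Complex.I).const_add w
  have hcont : ContinuousOn (fun t : ℝ => onComplex g (w + t * Complex.I)) (Set.Ioi 0) := by
    intro t ht
    have h1 : DifferentiableAt ℂ (onComplex g) (w + t * Complex.I) :=
      mdifferentiableAt_iff.mp (ModularFormClass.holo g ⟨_, him ht⟩)
    exact (ContinuousAt.comp (f := fun t : ℝ => w + t * Complex.I) h1.continuousAt
      (hline t).continuousAt).continuousWithinAt
  have hmeas {l : Filter ℝ} (hl : Set.Ioi 0 ∈ l) :
      StronglyMeasurableAtFilter (fun t : ℝ => onComplex g (w + t * Complex.I)) l :=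
    ⟨_, hl, hcont.aestronglyMeasurable measurableSet_Ioi⟩
  have hint : IntegrableOn (fun t : ℝ => onComplex g (w + t * Complex.I)) (Set.Ioi 0) := by
    rw [integrableOn_Ioi_iff_integrableAtFilter_atTop_nhdsWithin]
    refine ⟨?_, ?_, hcont.locallyIntegrableOn measurableSet_Ioi⟩
    · refine ((isBigO_exp_atImInfty g).comp_tendsto
        (tendsto_ofComplex_vertical w)).integrableAtFilter (hmeas (Ioi_mem_atTop 0)) ?_
      refine ⟨_, Ioi_mem_atTop 0, IntegrableOn.congr_fun (f := fun t : ℝ =>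
        Real.exp (-(2 * π) * w.im) * Real.exp (-(2 * π) * t))
        ((exp_neg_integrableOn_Ioi 0 (by positivity)).const_mul _) (fun t ht => ?_)
        measurableSet_Ioi⟩
      rw [Function.comp_apply, ofComplex_apply_of_im_pos (him (Set.mem_Ioi.mp ht))]
      change _ = Real.exp (-(2 * π) * (w + t * Complex.I).im)
      simp [← Real.exp_add, mul_add]
    · exact (Measure.finiteAt_nhdsWithin volume 0 (Set.Ioi 0)).integrableAtFilter_of_tendsto
        (hmeas self_mem_nhdsWithin) hb
  -- `E` is not controlled on the real axis, so its value at t = 0 is replaced by the limit `m`.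
  have hFTC := integral_Ioi_of_hasDerivAt_of_tendsto
    (f := Function.update (fun t : ℝ => E (w + t * Complex.I)) 0 m)
    (f' := fun t => 2 * π * Complex.I * (onComplex g (w + t * Complex.I) * Complex.I)) (a := 0)
    (m := 0) ?_ ?_ ((hint.mul_const _).const_mul _) ?_
  · rw [Function.update_self, integral_const_mul] at hFTC
    linear_combination -hFTC
  · rw [continuousWithinAt_update_same, Set.Ici_sdiff_left]
    exact hm
  · intro t ht
    have h1 := (hE ⟨_, him ht⟩).comp t (hline t)
    refine (HasDerivAt.congr_of_eventuallyEq (f := fun t : ℝ => E (w + t * Complex.I)) ?_ ?_)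
    · convert! h1 using 1
      rw [onComplex, ofComplex_apply_of_im_pos (him ht)]
      ring
    · filter_upwards [isOpen_ne.mem_nhds (ne_of_gt ht)] with s hs
      exact Function.update_of_ne hs _ _
  · refine (hE0.comp (tendsto_ofComplex_vertical w)).congr' ?_
    filter_upwards [Ioi_mem_atTop 0] with t ht
    rw [Function.update_of_ne (ne_of_gt ht), Function.comp_apply,
      ofComplex_apply_of_im_pos (him ht)]

lemma eichler_eq_of_primitive {E : ℂ → ℂ}
    (hE : ∀ τ : ℍ, HasDerivAt E (2 * π * Complex.I * g τ) τ)
    (hE0 : Tendsto (fun τ : ℍ => E τ) atImInfty (𝓝 0)) (τ : ℍ) : eichler g τ = E τ := by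
  have hline : Tendsto (fun t : ℝ => (τ : ℂ) + t * Complex.I) (𝓝[>] 0) (𝓝 τ) := by
    have : Continuous fun t : ℝ => (τ : ℂ) + t * Complex.I := by fun_prop
    simpa using (this.tendsto 0).mono_left nhdsWithin_le_nhds
  have hg : ContinuousAt (onComplex g) τ :=
    DifferentiableAt.continuousAt (𝕜 := ℂ) (mdifferentiableAt_iff.mp (ModularFormClass.holo g τ))
  exact integral_vertical_eq hE hE0 τ.im_pos.le ((hE τ).continuousAt.tendsto.comp hline)
    (hg.tendsto.comp hline)

variable [NeZero N]

variable (g) in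
/-- A cusp form of weight two has a primitive that vanishes at the cusp infinity. -/
lemma exists_primitive : ∃ E : ℂ → ℂ,
    (∀ τ : ℍ, HasDerivAt E (2 * π * Complex.I * g τ) τ) ∧
      Tendsto (fun τ : ℍ => E τ) atImInfty (𝓝 0) := by
  have hper := SlashInvariantFormClass.periodic_comp_ofComplex g
    (one_mem_strictPeriods_Gamma0 (N := N))
  set F := cuspFunction 1 g with hF
  have hF0 : F 0 = 0 := CuspFormClass.cuspFunction_apply_zero g one_pos
    one_mem_strictPeriods_Gamma0
  have hFd : DifferentiableOn ℂ (dslope F 0) (Metric.ball 0 1) :=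
    (Complex.differentiableOn_dslope (Metric.ball_mem_nhds 0 one_pos)).mpr
      (differentiableOn_cuspFunction_ball one_pos hper (ModularFormClass.holo g)
        (ModularFormClass.bdd_at_infty g))
  -- P is a primitive of F(q)/q, holomorphic at 0 because F(0) = 0. The chain rule for q = exp(2πiτ)
  -- contributes 2πi q, which restores 2πi g.
  obtain ⟨P, hP0, hP⟩ := hFd.isExactOn_ball.with_val_at 0 0
  refine ⟨fun z => P (qParam 1 z), fun τ => ?_, ?_⟩
  · have hq0 : qParam 1 τ ≠ 0 := Complex.exp_ne_zero _
    have hq : HasDerivAt (qParam 1) (qParam 1 τ * (2 * π * Complex.I)) τ := by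
      have := (((hasDerivAt_id (τ : ℂ)).const_mul (2 * π * Complex.I)).div_const ((1 : ℝ) : ℂ)).cexp
      exact this.congr_deriv (by simp [qParam])
    have h1 := (hP (qParam 1 τ) (by
      simpa using UpperHalfPlane.norm_qParam_lt_one 1 τ)).comp (τ : ℂ) hq
    have hFq : F (qParam 1 τ) = g τ := eq_cuspFunction τ one_ne_zero hper
    rw [dslope_of_ne _ hq0, slope_def_field, hF0, sub_zero, sub_zero, hFq] at h1
    convert! h1 using 1
    field_simp
  · have h2 : Tendsto P (𝓝 0) (𝓝 0) := by
      have := (hP 0 (Metric.mem_ball_self one_pos)).continuousAt.tendsto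
      rwa [hP0] at this
    exact h2.comp (qParam_tendsto_atImInfty one_pos)

/-- The transformation of Eichler integrals under Atkin-Lehner involutions. -/
theorem IsAtkinLehnerMatrix.eichler_smul {Q : ℕ} [NeZero Q] {W : GL (Fin 2) ℝ}
    (hW : IsAtkinLehnerMatrix N Q W) {lam : ℂ} (hsign : lam = 1 ∨ lam = -1)
    (hlam : (g : ℍ → ℂ) ∣[(2 : ℤ)] W = lam • (g : ℍ → ℂ)) (τ : ℍ) :
    eichler g (W • τ) = lam * (eichler g τ - cuspToInfty g (W⁻¹ • (∞ : OnePoint ℝ))) := by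
  obtain ⟨E, hE, hE0⟩ := exists_primitive g
  obtain ⟨c, hc⟩ := hW.exists_primitive_smul_sub_eq hlam hE
  rw [eichler_eq_of_primitive hE hE0, eichler_eq_of_primitive hE hE0]
  have hsq : lam * lam = 1 := by rcases hsign with rfl | rfl <;> norm_num
  suffices h : cuspToInfty g (W⁻¹ • (∞ : OnePoint ℝ)) = -(lam * c) by
    rw [h]
    linear_combination hc τ - c * hsq
  -- If `W` fixes ∞, letting τ → i∞ gives c = 0; otherwise W⁻¹∞ is the finite cusp `x` at which the
  -- denominator vanishes.
  by_cases hW10 : W 1 0 = 0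
  · have h1 : W⁻¹ • (∞ : OnePoint ℝ) = ∞ := by
      rw [inv_smul_eq_iff, OnePoint.smul_infty_eq_self_iff.mpr hW10]
    have h2 : c = 0 := by
      have h3 := (hE0.comp (tendsto_smul_atImInfty hW10)).sub (hE0.const_mul lam)
      simp only [Function.comp_apply, hc, mul_zero, sub_zero] at h3
      exact tendsto_nhds_unique tendsto_const_nhds h3
    rw [h1, h2, mul_zero, neg_zero]
    rfl
  · set x : ℝ := -(W 1 1) / W 1 0 with hx
    have hx0 : W 1 0 * x + W 1 1 = 0 := by rw [hx]; field_simp; ring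
    have h1 : W⁻¹ • (∞ : OnePoint ℝ) = (x : OnePoint ℝ) := by
      rw [inv_smul_eq_iff, OnePoint.smul_some_eq_ite, if_pos hx0]
    have hQpos : (0 : ℝ) < Q := by exact_mod_cast Nat.pos_of_ne_zero (NeZero.ne Q)
    have hQ : (Q : ℂ) ≠ 0 := by exact_mod_cast NeZero.ne Q
    have hW10' : (W 1 0 : ℂ) ≠ 0 := by exact_mod_cast hW10
    have him {t : ℝ} (ht : 0 < t) : 0 < ((x : ℂ) + t * Complex.I).im := by simpa using ht
    have hden {t : ℝ} (ht : 0 < t) :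
        denom W (ofComplex (x + t * Complex.I)) = W 1 0 * t * Complex.I := by
      rw [ofComplex_apply_of_im_pos (him ht), denom]
      have : (W 1 0 : ℂ) * x + W 1 1 = 0 := by exact_mod_cast hx0
      change (W 1 0 : ℂ) * (x + t * Complex.I) + W 1 1 = _
      linear_combination this
    have himW {t : ℝ} (ht : 0 < t) :
        (W • ofComplex (x + t * Complex.I)).im = Q / W 1 0 ^ 2 * t⁻¹ := by
      rw [UpperHalfPlane.im_smul_eq_div_normSq, hW.det_eq, hden ht,
        ofComplex_apply_of_im_pos (him ht), abs_of_pos hQpos]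
      simp [Complex.normSq_mul, UpperHalfPlane.im]
      field_simp
    -- Descending to `x` sends Wτ to i∞, where E vanishes; hence E(x + it) → -λc, as λ² = 1.
    have htend : Tendsto (fun t : ℝ => W • ofComplex (x + t * Complex.I)) (𝓝[>] 0) atImInfty := by
      refine tendsto_comap_iff.mpr (Tendsto.congr' ?_
        (tendsto_inv_nhdsGT_zero.const_mul_atTop (r := Q / W 1 0 ^ 2) (by positivity)))
      filter_upwards [self_mem_nhdsWithin] with t ht using (himW ht).symm
    rw [h1]
    refine integral_vertical_eq hE hE0 (w := x) (by simp) (b := 0) ?_ ?_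
    · have h2 := ((hE0.comp htend).sub_const c).const_mul lam
      rw [zero_sub, mul_neg] at h2
      refine h2.congr' ?_
      filter_upwards [self_mem_nhdsWithin] with t ht
      have h3 := hc (ofComplex (x + t * Complex.I))
      have h4 : ((ofComplex (x + t * Complex.I) : ℍ) : ℂ) = x + t * Complex.I := by
        rw [ofComplex_apply_of_im_pos (him ht)]
      rw [h4] at h3
      rw [Function.comp_apply, ← h3]
      linear_combination E (x + t * Complex.I) * hsq
    -- On this line Im(Wτ) is Q / (W₁₀² t), so g(x + it) is a constant times Im(Wτ)² g(Wτ), which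
    -- tends to 0 by cuspidality at ∞.
    · have h2 := ((tendsto_im_sq_mul_atImInfty g).comp htend).const_mul (-(lam * W 1 0 ^ 2 / Q))
      rw [mul_zero] at h2
      refine h2.congr' ?_
      filter_upwards [self_mem_nhdsWithin] with t ht
      have ht0 : (t : ℂ) ≠ 0 := by exact_mod_cast (ne_of_gt ht)
      rw [Function.comp_apply, hW.apply_smul hlam, himW ht, hden ht, onComplex]
      push_cast
      rw [mul_pow _ Complex.I, Complex.I_sq]
      field_simp
      linear_combination g (ofComplex (x + t * Complex.I)) * hsq

end Eichler

end

/-! ### The vector of Eichler integrals and the conclusion. -/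

section

lemma IsNewform.coe_ne_zero {N : ℕ} {f : S2 N} (hf : IsNewform f) : (f : ℍ → ℂ) ≠ 0 := fun h => by
  have h1 := hf.normalized
  rw [fourierCoeff, h, qExpansion_zero] at h1
  simp at h1

/-- The transformation of the vector of Eichler integrals of the conjugates of a form. -/
theorem eichlerVec_smul {N r Q : ℕ} [NeZero N] [NeZero Q] (hQN : Q ∣ N) {f : S2 N}
    {F : Fin r → S2 N} (hF : IsGaloisOrbit f F) {W : GL (Fin 2) ℝ}
    (hW : IsAtkinLehnerMatrix N Q W) {lam : ℂ} (hsign : lam = 1 ∨ lam = -1)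
    (hlam : (f : ℍ → ℂ) ∣[(2 : ℤ)] W = lam • (f : ℍ → ℂ)) (τ : ℍ) :
    eichlerVec F (W • τ) = lam • (eichlerVec F τ - cuspPeriodVec F W) := by
  funext j
  have hj : IsGaloisConjugate f (F j) := by
    have : F j ∈ Set.range F := ⟨j, rfl⟩
    rwa [hF.range_eq] at this
  exact hW.eichler_smul hsign (slash_eq_of_isGaloisConjugate hQN hW hj hsign hlam) τ

end

end KleinianMock

end

theorem theorem1p4 {N r : ℕ} [NeZero N]
    (f : KleinianMock.S2 N) (hf : KleinianMock.IsNewform f)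
    (F : Fin r → KleinianMock.S2 N) (hF : KleinianMock.IsGaloisOrbit f F)
    (ω ω' eta : Matrix (Fin r) (Fin r) ℂ) (hω : KleinianMock.IsPeriodPair F ω ω')
    (α β : Fin r → ℝ)
    (Q : ℕ) (hQN : Q ∣ N) (hQ : Nat.Coprime Q (N / Q))
    (W : GL (Fin 2) ℝ) (hW : KleinianMock.IsAtkinLehnerMatrix N Q W)
    (lam : ℂ) (hlam : (f : ℍ → ℂ) ∣[(2 : ℤ)] W = lam • (f : ℍ → ℂ)) :
    (lam = 1 ∨ lam = -1) ∧
    ∀ τ : ℍ,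
      (KleinianMock.sigma ω ω' eta α β (KleinianMock.eichlerVec F (W • τ)) ≠ 0 ↔
        KleinianMock.sigma ω ω' eta α β
          (lam • (KleinianMock.eichlerVec F τ - KleinianMock.cuspPeriodVec F W)) ≠ 0) ∧
      (KleinianMock.sigma ω ω' eta α β (KleinianMock.eichlerVec F (W • τ)) ≠ 0 →
        KleinianMock.zHat F ω ω' eta α β (W • τ) =
          KleinianMock.zetaHat ω ω' eta α β
            (lam • (KleinianMock.eichlerVec F τ - KleinianMock.cuspPeriodVec F W))) := by
  have : NeZero Q := ⟨fun h => NeZero.ne N (zero_dvd_iff.mp (h ▸ hQN))⟩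
  have hsign := hW.eigenvalue_eq_one_or hQN hf.coe_ne_zero hlam
  refine ⟨hsign, fun τ => ?_⟩
  have h := KleinianMock.eichlerVec_smul hQN hF hW hsign hlam τ
  rw [KleinianMock.zHat, h]
  exact ⟨Iff.rfl, fun _ => rfl⟩
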